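/- **Theorem 2 (universal consistency of Aurora with $k$-nearest neighbours).** Fix $K\ge 1$. Let $(\mu_i,\alpha_i)\overset{iid}{\sim}G$, $i=1,2,\dots$, with $\mu_i\in\mathbb R$ and $\alpha_i$ in an arbitrary measurable space, and, independently across $i$, given $(\mu_i,\alpha_i)$ let $Z_{i1},\dots,Z_{iK}\overset{iid}{\sim}F(\cdot\mid\mu_i,\alpha_i)$ be real-valued, where $G$ and $F$ are arbitrary subject to $\mu_i=\mathbb E[Z_{ij}\mid\mu_i,\alpha_i]$, $\mathbb E[\mu_i^2]<\infty$ and $\mathbb E[Z_{ij}^2]<\infty$. For $j\in\{1,\dots,K\}$ let $Y_i(j)=Z_{ij}$ and let $X_i^{(\cdot)}(j)\in\mathbb R^{K-1}$ be the vector of order statistics of the other $K-1$ replicates of unit $i$. Given features $W_1(j),\dots,W_N(j)$ in a Euclidean space, let $$\hat m_j(x)=\frac1k\sum_{i\in S_{k,j}(x)}Y_i(j),\qquad S_{k,j}(x)=\Big\{i\le N:\ \#\{l\le N,\ l\ne i:\ \|W_i(j)-x\|_2>\|W_l(j)-x\|_2\}<k\Big\},$$ and let $\hat\mu_i=\frac1K\sum_{j=1}^K\hat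 m_j(W_i(j))$, $i=1,\dots,N$. The features are one of the following. (a) (Randomized tie-breaking.) $W_i(j)=(X_i^{(\cdot)}(j),U_i(j))\in\mathbb R^{K}$, where the $U_i(j)$ are i.i.d. uniform on $[0,\varepsilon]$ and independent of all $(\mu_i,\alpha_i,Z_i)$, for an arbitrary fixed $\varepsilon>0$. (b) (No ties.) $W_i(j)=X_i^{(\cdot)}(j)\in\mathbb R^{K-1}$, when for all $j$, all $i$ and all $i_1\neq i_2$ (possibly $i\in\{i_1,i_2\}$) the event $\|X_{i_1}^{(\cdot)}(j)-X_i^{(\cdot)}(j)\|_2=\|X_{i_2}^{(\cdot)}(j)-X_i^{(\cdot)}(j)\|_2$ has probability $0$. Let $k=k_N\in\mathbb N$ satisfy $k_N\to\infty$ and $k_N/N\to0$ as $N\to\infty$. Then, in case (a) and in case (b), all $(\mu_i-\hat\mu_i)^2$ are integrable, $\frac1N\sum_{i=1}^N\mathbb E[(\mu_i-\hat\mu_i)^2]$ converges as $N\to\infty$, and $$\limsup_{N\to\infty}\frac1N\sum_{i=1}^N\mathbb E\big[(\mu_i-\hat\mu_i)^2\big]=\overline{\mathcal R}_{K-1}(G,F)\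 \le\ \mathcal R_{K-1}(G,F),$$ where, for any $i\ge1$ and any $j\in\{1,\dots,K\}$, $$\overline{\mathcal R}_{K-1}(G,F)=\mathbb E\Big[\Big(\mu_i-\frac1K\sum_{j=1}^K\mathbb E[\mu_i\mid X_i^{(\cdot)}(j)]\Big)^2\Big],\qquad \mathcal R_{K-1}(G,F)=\mathbb E\Big[\big(\mu_i-\mathbb E[\mu_i\mid X_i^{(\cdot)}(j)]\big)^2\Big].$$ The inequality between the two risks holds for all $i$ and $j$ and needs no assumption on ties. -/

import Mathlib

open MeasureTheory ProbabilityTheory Filter Topology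

noncomputable section

namespace Aurora

/-! Every unit has `m + 1` replicates (so the number of replicates is `K = m + 1 ≥ 1`). -/

/-- The order statistics of the `m` replicates of one unit that remain after the replicate
with index `j` is held out, as a vector of the Euclidean space `ℝ^m`. -/
def orderStats {m : ℕ} (z : Fin (m + 1) → ℝ) (j : Fin (m + 1)) : EuclideanSpace ℝ (Fin m) :=
  WithLp.toLp 2 ((j.removeNth z) ∘ Tuple.sort (j.removeNth z))

/-- The order statistics with a tie-breaking coordinate `u` appended, in `ℝ^(m+1)`. -/
def orderStatsTie {m : ℕ} (z : Fin (m + 1) → ℝ) (j : Fin (m + 1)) (u : ℝ) :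
    EuclideanSpace ℝ (Fin (m + 1)) :=
  WithLp.toLp 2 (Fin.snoc (α := fun _ => ℝ) (orderStats z j) u)

/-- Indices `i` of the sample `W` such that fewer than `k` other sample points are strictly
closer to `x` than `W i`. -/
def nearest {E : Type*} [NormedAddCommGroup E] {N : ℕ} (k : ℕ) (W : Fin N → E) (x : E) :
    Finset (Fin N) :=
  {i | (Finset.card {l : Fin N | l ≠ i ∧ ‖W i - x‖ > ‖W l - x‖}) < k}

/-- The `k`-nearest-neighbour regression estimator of `Y` on `W`, evaluated at `x`. -/
def kNN {E : Type*} [NormedAddCommGroup E] {N : ℕ} (k : ℕ) (W : Fin N → E) (Y : Fin N → ℝ)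
    (x : E) : ℝ :=
  (1 / (k : ℝ)) * ∑ i ∈ nearest k W x, Y i

/-- The Aurora estimate for unit `i`: for every held-out index `j`, the responses `z · j` are
regressed on the features `W · j` with the regression procedure `fit`, the fitted function is
evaluated at the feature `W i j`, and the results are averaged over `j`. -/
def aurora {E : Type*} {N K : ℕ} (fit : (Fin N → E) → (Fin N → ℝ) → E → ℝ)
    (W : Fin N → Fin K → E) (z : Fin N → Fin K → ℝ) (i : Fin N) : ℝ :=
  (1 / (K : ℝ)) * ∑ j, fit (fun i' => W i' j) (fun i' => z i' j) (W i j)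

/-- Aurora with `k`-nearest neighbours on the order statistics. -/
def auroraKNN {m N : ℕ} (k : ℕ) (z : Fin N → Fin (m + 1) → ℝ) (i : Fin N) : ℝ :=
  aurora (kNN k) (fun i' j => orderStats (z i') j) z i

/-- Aurora with `k`-nearest neighbours on the order statistics augmented by the tie-breakers
`u`. -/
def auroraKNNTie {m N : ℕ} (k : ℕ) (z u : Fin N → Fin (m + 1) → ℝ) (i : Fin N) : ℝ :=
  aurora (kNN k) (fun i' j => orderStatsTie (z i') j (u i' j)) z i

/-- The empirical Bayes model with replicates: the units `((μ i, α i), Z i)` are independent,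
`(μ i, α i) ∼ G`, given `(μ i, α i)` the replicates `Z i j` are i.i.d. from `F (μ i, α i)`, and
`μ i` is the mean of `F (μ i, α i)`. -/
structure ReplicateModel {A Ω : Type*} [MeasurableSpace A] [MeasurableSpace Ω] {m : ℕ}
    (G : Measure (ℝ × A)) (F : Kernel (ℝ × A) ℝ) (P : Measure Ω)
    (μ : ℕ → Ω → ℝ) (α : ℕ → Ω → A) (Z : ℕ → Fin (m + 1) → Ω → ℝ) : Prop where
  measurable_mean : ∀ i, Measurable (μ i)
  measurable_nuisance : ∀ i, Measurable (α i)
  measurable_replicate : ∀ i j, Measurable (Z i j)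
  units_indep : iIndepFun (fun i ω => ((μ i ω, α i ω), fun j => Z i j ω)) P
  unit_law : ∀ (i : ℕ) (B : Set (ℝ × A)) (C : Fin (m + 1) → Set ℝ), MeasurableSet B →
    (∀ j, MeasurableSet (C j)) →
    P {ω | (μ i ω, α i ω) ∈ B ∧ ∀ j, Z i j ω ∈ C j} = ∫⁻ a in B, ∏ j, F a (C j) ∂G
  mean_eq : ∀ᵐ a ∂G, Integrable (fun z : ℝ => z) (F a) ∧ ∫ z, z ∂(F a) = a.1

/-- The variables `U i j` are i.i.d. uniform on `[0, ε]` and independent of the model. -/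
structure TieBreakers {A Ω : Type*} [MeasurableSpace A] [MeasurableSpace Ω] {m : ℕ}
    (ε : ℝ) (P : Measure Ω) (μ : ℕ → Ω → ℝ) (α : ℕ → Ω → A)
    (Z U : ℕ → Fin (m + 1) → Ω → ℝ) : Prop where
  measurable : ∀ i j, Measurable (U i j)
  uniform : ∀ i j, pdf.IsUniform (U i j) (Set.Icc 0 ε) P volume
  indep : iIndepFun (fun p : ℕ × Fin (m + 1) => U p.1 p.2) P
  indep_model : IndepFun (fun ω i j => U i j ω)
    (fun ω i => ((μ i ω, α i ω), fun j => Z i j ω)) P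

/-- Almost surely no two distinct units are equally far from a unit, for the Euclidean distance
between the vectors of order statistics. -/
def NoTies {Ω : Type*} [MeasurableSpace Ω] {m : ℕ} (P : Measure Ω)
    (Z : ℕ → Fin (m + 1) → Ω → ℝ) : Prop :=
  ∀ (j : Fin (m + 1)) (i i₁ i₂ : ℕ), i₁ ≠ i₂ → ∀ᵐ ω ∂P,
    ‖orderStats (fun l => Z i₁ l ω) j - orderStats (fun l => Z i l ω) j‖ ≠
      ‖orderStats (fun l => Z i₂ l ω) j - orderStats (fun l => Z i l ω) j‖

/-- The oracle `m*`: the conditional expectation `E[μ | order statistics without replicate j]`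
of one unit with mean `μ` and replicates `Z`. -/
def oracle {Ω : Type*} [MeasurableSpace Ω] {m : ℕ} (P : Measure Ω) (μ : Ω → ℝ)
    (Z : Fin (m + 1) → Ω → ℝ) (j : Fin (m + 1)) : Ω → ℝ :=
  P[μ | MeasurableSpace.comap (fun ω => orderStats (fun l => Z l ω) j) inferInstance]

/-- The Bayes risk based on all replicates but the one with index `j`. -/
def bayesRisk {Ω : Type*} [MeasurableSpace Ω] {m : ℕ} (P : Measure Ω) (μ : Ω → ℝ)
    (Z : Fin (m + 1) → Ω → ℝ) (j : Fin (m + 1)) : ℝ :=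
  ∫ ω, (μ ω - oracle P μ Z j ω) ^ 2 ∂P

/-- The risk of the averaged oracle. -/
def avgOracleRisk {Ω : Type*} [MeasurableSpace Ω] {m : ℕ} (P : Measure Ω) (μ : Ω → ℝ)
    (Z : Fin (m + 1) → Ω → ℝ) : ℝ :=
  ∫ ω, (μ ω - (1 / ((m + 1 : ℕ) : ℝ)) * ∑ j, oracle P μ Z j ω) ^ 2 ∂P

/-- The average mean squared error over the first `N` units of the estimates `est i`. -/
def avgMSE {Ω : Type*} [MeasurableSpace Ω] (P : Measure Ω) (μ : ℕ → Ω → ℝ) (N : ℕ)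
    (est : Fin N → Ω → ℝ) : ℝ :=
  (1 / (N : ℝ)) * ∑ i : Fin N, ∫ ω, (μ i ω - est i ω) ^ 2 ∂P

/-- All squared errors are integrable, and the average mean squared error converges to `R`;
in particular its limit superior is `R`. -/
def MSEConverges {Ω : Type*} [MeasurableSpace Ω] (P : Measure Ω) (μ : ℕ → Ω → ℝ)
    (est : (N : ℕ) → Fin N → Ω → ℝ) (R : ℝ) : Prop :=
  (∀ N (i : Fin N), Integrable (fun ω => (μ i ω - est N i ω) ^ 2) P) ∧
  Tendsto (fun N => avgMSE P μ N (est N)) atTop (𝓝 R) ∧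
  limsup (fun N => avgMSE P μ N (est N)) atTop = R

end Aurora

end

/-!
The limit in both cases comes from Stone's universal consistency theorem for nearest neighbours,
in an in-sample version: for independent pairs `(W i, Y i)` whose features have a common law without
ties and whose regression function is `f`, the mean squared errors of the nearest-neighbour
estimates of `f (W i)`, averaged over the sample points `W i` themselves, tend to zero
(`Aurora.tendsto_avg_integral_sq_kNN_sub`).

The average over the sample points makes most of that argument deterministic.

* By Stone's lemma (`Aurora.exists_card_nearest_inverse_le`), each of finitely many distinct sample
  points is among the `k` nearest neighbours of at most `γ k` sample points, where `γ` depends on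
  the dimension only. Hence an average over sample points of averages over their neighbours is at
  most `γ` times the plain average (`Aurora.sum_sum_nearest_le`).
* Covering a compact set by finitely many small balls shows that all but `O(k)` of the sample
  points in that set have all their neighbours close by
  (`Aurora.exists_card_far_neighbour_le`), so that `k / N → 0` removes them from the average.
* Given the features, the noise `Y i - f (W i)` of different units is orthogonal
  (`Aurora.integral_indicator_mul_noise_eq_zero`), so that averaging over `k` neighbours leaves an
  error of order `1 / k`. For the bias, `f` is replaced by a continuous function of compact
  support close to it in `L²`; Stone's lemma controls the effect of the replacement.

In the replicate model, the replicates of a unit are exchangeable given the latent pair. So one and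
the same function `f` of the order statistics is the oracle for all units and all held-out indices
(`Aurora.ReplicateModel.exists_oracle_eq_comp`), and it is also the regression function of the
held-out replicate, which has conditional mean `μ` given the latent pair
(`Aurora.ReplicateModel.setIntegral_heldOut_sub_oracle`). Averaging over the held-out index, the
Aurora estimates approach the averaged oracle in mean square, and their risk approaches its risk.
An independent tie-breaker does not change the regression function, and it makes the law of the
features charge no sphere, which rules out ties
(`Aurora.map_orderStatsTie_sphere_eq_zero`, `Aurora.ae_norm_sub_ne_of_sphere_null`).

The comparison of the two risks is Jensen's inequality, as the Bayes risks for the different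
held-out indices coincide.
-/

namespace Aurora

/-! ### Counting nearest neighbours -/

section Combinatorics

variable {E : Type*} [NormedAddCommGroup E] {N : ℕ}

theorem mem_nearest {k : ℕ} {W : Fin N → E} {x : E} {i : Fin N} :
    i ∈ nearest k W x ↔
      (Finset.card {l : Fin N | l ≠ i ∧ ‖W i - x‖ > ‖W l - x‖}) < k := by
  simp [nearest]

/-- Points that are all strictly closer to `x` than the `k`-nearest neighbour `W l` of `x` are
fewer than `k`. -/
theorem card_lt_of_mem_nearest {k : ℕ} {W : Fin N → E} {x : E} {l : Fin N}
    (hl : l ∈ nearest k W x) (T : Finset (Fin N)) (hT : ∀ i ∈ T, ‖W i - x‖ < ‖W l - x‖) :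
    T.card < k := by
  refine lt_of_le_of_lt (Finset.card_le_card fun i hi => ?_) (mem_nearest.1 hl)
  simp only [Finset.mem_filter, Finset.mem_univ, true_and]
  exact ⟨fun h => by simpa [h] using hT i hi, hT i hi⟩

/-- Without ties there are at most `k` points among the `k` nearest ones. -/
theorem card_nearest_le {k : ℕ} {W : Fin N → E} {x : E}
    (hW : ∀ i l, i ≠ l → ‖W i - x‖ ≠ ‖W l - x‖) : (nearest k W x).card ≤ k := by
  rcases (nearest k W x).eq_empty_or_nonempty with h | h
  · simp [h]
  obtain ⟨i, hi, hmax⟩ := Finset.exists_max_image _ (fun l => ‖W l - x‖) h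
  have := card_lt_of_mem_nearest hi ((nearest k W x).erase i) fun l hl =>
    lt_of_le_of_ne (hmax l (Finset.mem_of_mem_erase hl)) (hW l i (Finset.ne_of_mem_erase hl))
  rw [Finset.card_erase_of_mem hi] at this
  omega

theorem le_card_nearest {k : ℕ} (hk : k ≤ N) (W : Fin N → E) (x : E) :
    k ≤ (nearest k W x).card := by
  by_contra! h
  have hne : ((nearest k W x)ᶜ).Nonempty := by
    rw [← Finset.card_pos, Finset.card_compl, Fintype.card_fin]
    omega
  obtain ⟨i, hi, hmin⟩ := Finset.exists_min_image _ (fun l => ‖W l - x‖) hne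
  refine Finset.mem_compl.1 hi (mem_nearest.2 (lt_of_le_of_lt (Finset.card_le_card ?_) h))
  intro l hl
  simp only [Finset.mem_filter, Finset.mem_univ, true_and] at hl
  by_contra hl'
  exact absurd (hmin l (Finset.mem_compl.2 hl')) (not_le.2 hl.2)

/-- If `B` is covered by finitely many balls of radius `δ / 2`, then within each of these balls
fewer than `k` sample points can have one of their `k` nearest neighbours at distance `≥ δ`. -/
theorem exists_card_far_neighbour_le {B : Set E} (hB : TotallyBounded B) {δ : ℝ} (hδ : 0 < δ) :
    ∃ M : ℕ, ∀ (N k : ℕ) (W : Fin N → E) (T : Finset (Fin N)),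
      (∀ i ∈ T, W i ∈ B ∧ ∃ l ∈ nearest k W (W i), δ ≤ ‖W l - W i‖) → T.card ≤ M * k := by
  classical
  obtain ⟨t, ht, hcov⟩ := Metric.totallyBounded_iff.1 hB (δ / 2) (by positivity)
  lift t to Finset E using ht
  refine ⟨t.card, fun N k W T hT => ?_⟩
  have hsub : T ⊆ t.biUnion fun c => {i ∈ T | W i ∈ Metric.ball c (δ / 2)} := by
    intro i hi
    obtain ⟨c, hc, hic⟩ := Set.mem_iUnion₂.1 (hcov (hT i hi).1)
    exact Finset.mem_biUnion.2 ⟨c, hc, Finset.mem_filter.2 ⟨hi, hic⟩⟩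
  refine (Finset.card_le_card hsub).trans (Finset.card_biUnion_le_card_mul _ _ _ fun c _ => ?_)
  rcases ({i ∈ T | W i ∈ Metric.ball c (δ / 2)} : Finset _).eq_empty_or_nonempty with h | ⟨i, hi⟩
  · rw [h]
    simp
  rw [Finset.mem_filter] at hi
  obtain ⟨l, hl, hlδ⟩ := (hT i hi.1).2
  refine (card_lt_of_mem_nearest hl _ fun i' hi' => ?_).le
  refine lt_of_lt_of_le ?_ hlδ
  rw [← dist_eq_norm]
  have h1 := Metric.mem_ball.1 hi.2
  have h2 := Metric.mem_ball.1 (Finset.mem_filter.1 hi').2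
  linarith [dist_triangle_right (W i') (W i) c]

end Combinatorics

/-! ### Stone's lemma -/

section Cones

variable {E : Type*} [NormedAddCommGroup E] [InnerProductSpace ℝ E]

/-- Two nonzero vectors whose directions are less than `1` apart span an angle below `60°`, so
that subtracting the shorter one from the longer one shortens the latter. -/
theorem norm_sub_lt_of_norm_normalize_sub_lt {u v : E} (hu : u ≠ 0) (huv : ‖u‖ ≤ ‖v‖)
    (h : ‖(‖u‖⁻¹ : ℝ) • u - (‖v‖⁻¹ : ℝ) • v‖ < 1) : ‖u - v‖ < ‖v‖ := by
  have hu0 : 0 < ‖u‖ := norm_pos_iff.2 hu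
  have hv0 : 0 < ‖v‖ := hu0.trans_le huv
  have h2 : ‖(‖u‖⁻¹ : ℝ) • u - (‖v‖⁻¹ : ℝ) • v‖ ^ 2 < 1 := by
    nlinarith [norm_nonneg ((‖u‖⁻¹ : ℝ) • u - (‖v‖⁻¹ : ℝ) • v)]
  rw [norm_sub_sq_real, norm_smul, norm_smul, norm_inv, norm_inv, norm_norm, norm_norm,
    inv_mul_cancel₀ hu0.ne', inv_mul_cancel₀ hv0.ne', real_inner_smul_left,
    real_inner_smul_right] at h2
  have h3 : ‖u‖ * ‖v‖ < 2 * inner ℝ u v := by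
    have : 1 < 2 * (‖u‖⁻¹ * (‖v‖⁻¹ * inner ℝ u v)) := by linarith
    calc ‖u‖ * ‖v‖ = ‖u‖ * ‖v‖ * 1 := by ring
      _ < ‖u‖ * ‖v‖ * (2 * (‖u‖⁻¹ * (‖v‖⁻¹ * inner ℝ u v))) := by gcongr
      _ = 2 * inner ℝ u v := by field_simp
  have h4 : ‖u - v‖ ^ 2 < ‖v‖ ^ 2 := by
    rw [norm_sub_sq_real]
    nlinarith
  exact lt_of_pow_lt_pow_left₀ 2 hv0.le h4

/-- **Stone's lemma.** In a finite-dimensional Euclidean space there is a constant `γ` such that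
a sample point is among the `k` nearest neighbours of at most `γ k` sample points, if the sample
points are distinct. The space around `W l` is divided into finitely many cones of small angle.
In each cone, let `W i` be the point furthest from `W l` that has `W l` as a neighbour: all the
others are closer to `W i` than `W l` is, so there are at most `k` of them. -/
theorem exists_card_nearest_inverse_le [FiniteDimensional ℝ E] :
    ∃ γ : ℕ, ∀ (N k : ℕ) (W : Fin N → E), Function.Injective W → ∀ l : Fin N,
      (Finset.card {i : Fin N | l ∈ nearest k W (W i)}) ≤ γ * k := by
  classical
  obtain ⟨t, ht, hcov⟩ := Metric.totallyBounded_iff.1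
    (isCompact_sphere (0 : E) 1).totallyBounded (1 / 2) (by norm_num)
  lift t to Finset E using ht
  refine ⟨t.card + 1, fun N k W hW l => ?_⟩
  rcases Nat.eq_zero_or_pos k with rfl | hk
  · simp [mem_nearest]
  set T : Finset (Fin N) := {i : Fin N | l ∈ nearest k W (W i)} with hTdef
  let dir : Fin N → E := fun i => (‖W i - W l‖⁻¹ : ℝ) • (W i - W l)
  have hsub : T ⊆ insert l (t.biUnion fun c =>
      {i ∈ T.erase l | dir i ∈ Metric.ball c (1 / 2)}) := by
    intro i hi
    rw [Finset.mem_insert]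
    refine or_iff_not_imp_left.2 fun hil => ?_
    have h0 : W i - W l ≠ 0 := sub_ne_zero.2 fun h => hil (hW h)
    have hdir : dir i ∈ Metric.sphere (0 : E) 1 := by
      rw [mem_sphere_zero_iff_norm, norm_smul, norm_inv, norm_norm,
        inv_mul_cancel₀ (norm_ne_zero_iff.2 h0)]
    obtain ⟨c, hc, hic⟩ := Set.mem_iUnion₂.1 (hcov hdir)
    exact Finset.mem_biUnion.2
      ⟨c, hc, Finset.mem_filter.2 ⟨Finset.mem_erase.2 ⟨hil, hi⟩, hic⟩⟩
  refine (Finset.card_le_card hsub).trans ((Finset.card_insert_le _ _).trans ?_)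
  rw [add_mul, one_mul]
  refine add_le_add (Finset.card_biUnion_le_card_mul _ _ _ fun c _ => ?_) hk
  rcases ({i ∈ T.erase l | dir i ∈ Metric.ball c (1 / 2)} : Finset _).eq_empty_or_nonempty
    with h | h
  · rw [h]
    simp
  obtain ⟨i, hi, hmax⟩ := Finset.exists_max_image _ (fun i => ‖W i - W l‖) h
  rw [Finset.mem_filter, Finset.mem_erase] at hi
  have hl : l ∈ nearest k W (W i) := by
    have := hi.1.2
    rw [hTdef, Finset.mem_filter] at this
    exact this.2
  refine (card_lt_of_mem_nearest hl _ fun i' hi' => ?_).le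
  have hi'' := hi'
  rw [Finset.mem_filter, Finset.mem_erase] at hi'
  have h0 : W i' - W l ≠ 0 := sub_ne_zero.2 fun h => hi'.1.1 (hW h)
  have := norm_sub_lt_of_norm_normalize_sub_lt h0 (hmax i' hi'') (by
    have h1 := Metric.mem_ball.1 hi.2
    have h2 := Metric.mem_ball.1 hi'.2
    have h3 := dist_triangle_right (dir i') (dir i) c
    rw [dist_eq_norm] at h3
    refine lt_of_le_of_lt h3 ?_
    linarith)
  rwa [sub_sub_sub_cancel_right, norm_sub_rev (W i) (W l)] at this

end Cones

/-! ### Averages over neighbours -/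

section Averages

variable {E : Type*} [NormedAddCommGroup E] {N k γ : ℕ} {W : Fin N → E}

/-- A bound on the number of points that have `W l` among their neighbours turns a double sum
over neighbours into a single sum. -/
theorem sum_sum_nearest_le
    (hγ : ∀ l : Fin N, (Finset.card {i : Fin N | l ∈ nearest k W (W i)}) ≤ γ * k)
    {a : Fin N → ℝ} (ha : ∀ l, 0 ≤ a l) :
    ∑ i, ∑ l ∈ nearest k W (W i), a l ≤ γ * k * ∑ l, a l := by
  have h : ∑ i, ∑ l ∈ nearest k W (W i), a l
      = ∑ l, ∑ i with l ∈ nearest k W (W i), a l :=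
    Finset.sum_comm' (by simp)
  rw [h, Finset.mul_sum]
  refine Finset.sum_le_sum fun l _ => ?_
  rw [Finset.sum_const, nsmul_eq_mul]
  exact mul_le_mul_of_nonneg_right (by exact_mod_cast hγ l) (ha l)

theorem card_nearest_eq (hkN : k ≤ N) {x : E}
    (hW : ∀ i l, i ≠ l → ‖W i - x‖ ≠ ‖W l - x‖) : (nearest k W x).card = k :=
  le_antisymm (card_nearest_le hW) (le_card_nearest hkN W x)

/-- Jensen's inequality for the neighbour average. -/
theorem sq_sub_kNN_le (hk : 0 < k) {x : E} (hcard : (nearest k W x).card = k) (f : E → ℝ) :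
    (f x - kNN k W (fun l => f (W l)) x) ^ 2
      ≤ (1 / (k : ℝ)) * ∑ l ∈ nearest k W x, (f x - f (W l)) ^ 2 := by
  have hk' : (0 : ℝ) < k := by exact_mod_cast hk
  have h1 : f x - kNN k W (fun l => f (W l)) x
      = (1 / (k : ℝ)) * ∑ l ∈ nearest k W x, (f x - f (W l)) := by
    rw [Finset.sum_sub_distrib, Finset.sum_const, hcard, nsmul_eq_mul, kNN]
    field_simp
  have h2 := sq_sum_le_card_mul_sum_sq (s := nearest k W x) (f := fun l => f x - f (W l))
  rw [hcard] at h2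
  rw [h1, mul_pow]
  calc (1 / (k : ℝ)) ^ 2 * (∑ l ∈ nearest k W x, (f x - f (W l))) ^ 2
      ≤ (1 / (k : ℝ)) ^ 2 * (k * ∑ l ∈ nearest k W x, (f x - f (W l)) ^ 2) := by gcongr
    _ = (1 / (k : ℝ)) * ∑ l ∈ nearest k W x, (f x - f (W l)) ^ 2 := by field_simp

/-- The bias of the neighbour average of `f` is controlled by the distance from `f` to a bounded
uniformly continuous function `g`: the neighbours of all but few sample points are close. -/
theorem sum_sq_sub_kNN_le (hk : 0 < k) (hcard : ∀ i, (nearest k W (W i)).card = k)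
    (hγ : ∀ l : Fin N, (Finset.card {i : Fin N | l ∈ nearest k W (W i)}) ≤ γ * k)
    {B : Set E} {δ : ℝ} {M : ℕ}
    (hM : ∀ T : Finset (Fin N),
      (∀ i ∈ T, W i ∈ B ∧ ∃ l ∈ nearest k W (W i), δ ≤ ‖W l - W i‖) → T.card ≤ M * k)
    (f : E → ℝ) {g : E → ℝ} {C η : ℝ} (hC : ∀ x, |g x| ≤ C)
    (hg : ∀ x y, ‖y - x‖ < δ → |g x - g y| ≤ η) :
    ∑ i, (f (W i) - kNN k W (fun l => f (W l)) (W i)) ^ 2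
      ≤ 3 * (1 + γ) * ∑ i, (f (W i) - g (W i)) ^ 2
        + 3 * (N * η ^ 2 + (2 * C) ^ 2 * (M * k + ∑ i, Bᶜ.indicator (fun _ => (1 : ℝ)) (W i))) := by
  classical
  have hk' : (0 : ℝ) < k := by exact_mod_cast hk
  -- the sample points in `B` with a neighbour at distance at least `δ`
  set T : Finset (Fin N) := {i | W i ∈ B ∧ ∃ l ∈ nearest k W (W i), δ ≤ ‖W l - W i‖} with hT
  have hTcard : T.card ≤ M * k := hM T fun i hi => by simpa [hT] using hi
  have hvar : ∀ i, ∀ l ∈ nearest k W (W i), (g (W i) - g (W l)) ^ 2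
      ≤ η ^ 2 + (2 * C) ^ 2 * ((if i ∈ T then 1 else 0) +
        Bᶜ.indicator (fun _ => (1 : ℝ)) (W i)) := by
    intro i l hl
    have hglob : (g (W i) - g (W l)) ^ 2 ≤ (2 * C) ^ 2 := by
      rw [← sq_abs]
      refine pow_le_pow_left₀ (abs_nonneg _) ?_ 2
      linarith [abs_sub (g (W i)) (g (W l)), hC (W i), hC (W l)]
    by_cases hiB : W i ∈ B
    · by_cases hfar : ∃ l ∈ nearest k W (W i), δ ≤ ‖W l - W i‖
      · have hiT : i ∈ T := by
          simp only [hT, Finset.mem_filter, Finset.mem_univ, true_and]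
          exact ⟨hiB, hfar⟩
        have : Bᶜ.indicator (fun _ => (1 : ℝ)) (W i) = 0 := by simp [hiB]
        rw [if_pos hiT, this]
        nlinarith [sq_nonneg η]
      · push Not at hfar
        have h1 := hg _ _ (hfar l hl)
        have h2 : (g (W i) - g (W l)) ^ 2 ≤ η ^ 2 := by
          rw [← sq_abs]
          exact pow_le_pow_left₀ (abs_nonneg _) h1 2
        have h3 : (0 : ℝ) ≤ Bᶜ.indicator (fun _ => (1 : ℝ)) (W i) :=
          Set.indicator_nonneg (fun _ _ => zero_le_one) _
        have h4 : (0 : ℝ) ≤ if i ∈ T then 1 else 0 := by split_ifs <;> norm_num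
        have := mul_nonneg (sq_nonneg (2 * C)) (add_nonneg h4 h3)
        linarith
    · have : Bᶜ.indicator (fun _ => (1 : ℝ)) (W i) = 1 := by simp [hiB]
      have h4 : (0 : ℝ) ≤ if i ∈ T then 1 else 0 := by split_ifs <;> norm_num
      have := mul_nonneg (sq_nonneg (2 * C)) h4
      rw [‹Bᶜ.indicator (fun _ => (1 : ℝ)) (W i) = 1›]
      nlinarith [sq_nonneg η]
  have hstone := sum_sum_nearest_le hγ (a := fun l => (f (W l) - g (W l)) ^ 2)
    fun l => sq_nonneg _
  calc ∑ i, (f (W i) - kNN k W (fun l => f (W l)) (W i)) ^ 2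
      ≤ ∑ i, (1 / (k : ℝ)) * ∑ l ∈ nearest k W (W i), (f (W i) - f (W l)) ^ 2 :=
        Finset.sum_le_sum fun i _ => sq_sub_kNN_le hk (hcard i) f
    _ ≤ ∑ i, (1 / (k : ℝ)) * ∑ l ∈ nearest k W (W i), (3 * (f (W i) - g (W i)) ^ 2
          + 3 * (f (W l) - g (W l)) ^ 2 + 3 * (η ^ 2 + (2 * C) ^ 2 *
            ((if i ∈ T then 1 else 0) + Bᶜ.indicator (fun _ => (1 : ℝ)) (W i)))) := by
        gcongr with i _ l hl
        have := hvar i l hl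
        nlinarith [sq_nonneg ((f (W i) - g (W i)) - (g (W i) - g (W l))),
          sq_nonneg ((f (W i) - g (W i)) + (f (W l) - g (W l))),
          sq_nonneg ((g (W i) - g (W l)) + (f (W l) - g (W l)))]
    _ = 3 * ∑ i, (f (W i) - g (W i)) ^ 2
          + 3 * ((1 / (k : ℝ)) * ∑ i, ∑ l ∈ nearest k W (W i), (f (W l) - g (W l)) ^ 2)
          + 3 * (N * η ^ 2 + (2 * C) ^ 2 *
            (T.card + ∑ i, Bᶜ.indicator (fun _ => (1 : ℝ)) (W i))) := by
        have hTc : ∑ i, (if i ∈ T then (1 : ℝ) else 0) = T.card := by simp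
        have : ∀ i, (1 / (k : ℝ)) * ∑ l ∈ nearest k W (W i), (3 * (f (W i) - g (W i)) ^ 2
            + 3 * (f (W l) - g (W l)) ^ 2 + 3 * (η ^ 2 + (2 * C) ^ 2 *
              ((if i ∈ T then 1 else 0) + Bᶜ.indicator (fun _ => (1 : ℝ)) (W i))))
            = 3 * (f (W i) - g (W i)) ^ 2
              + 3 * ((1 / (k : ℝ)) * ∑ l ∈ nearest k W (W i), (f (W l) - g (W l)) ^ 2)
              + 3 * (η ^ 2 + (2 * C) ^ 2 *
              ((if i ∈ T then 1 else 0) + Bᶜ.indicator (fun _ => (1 : ℝ)) (W i))) := by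
          intro i
          rw [Finset.sum_add_distrib, Finset.sum_add_distrib, Finset.sum_const,
            Finset.sum_const, hcard, ← Finset.mul_sum]
          simp only [nsmul_eq_mul]
          field_simp
        simp_rw [this, Finset.sum_add_distrib, ← Finset.mul_sum, Finset.sum_add_distrib,
          ← Finset.mul_sum, Finset.sum_add_distrib, hTc]
        simp
    _ ≤ _ := by
        have h1 : (1 / (k : ℝ)) * ∑ i, ∑ l ∈ nearest k W (W i), (f (W l) - g (W l)) ^ 2
            ≤ γ * ∑ l, (f (W l) - g (W l)) ^ 2 := by
          refine (mul_le_mul_of_nonneg_left hstone (by positivity)).trans (le_of_eq ?_)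
          field_simp
        have h2 : (T.card : ℝ) ≤ M * k := by exact_mod_cast hTcard
        have h3 := mul_le_mul_of_nonneg_left h2 (sq_nonneg (2 * C))
        linarith

end Averages

/-! ### Orthogonality of the noise -/

section Noise

variable {Ω : Type*} [MeasurableSpace Ω] {P : Measure Ω} [IsProbabilityMeasure P]

/-- A variable `ξ` with conditional mean zero given `X` stays orthogonal to functions of `(X, ρ)`
when `ρ` is independent of `(X, ξ)`; the factor `c ρ` may be unbounded. -/
theorem integral_indicator_mul_eq_zero {α β : Type*} [MeasurableSpace α] [MeasurableSpace β]
    {X : Ω → α} {ξ : Ω → ℝ} {ρ : Ω → β} (hX : Measurable X) (hξ : Measurable ξ)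
    (hρ : Measurable ρ) (hind : IndepFun (fun ω => (X ω, ξ ω)) ρ P)
    (horth : ∀ S, MeasurableSet S → ∫ ω in X ⁻¹' S, ξ ω ∂P = 0)
    {T : Set (α × β)} (hT : MeasurableSet T) {c : β → ℝ} (hc : Measurable c) :
    ∫ ω, T.indicator (fun _ => (1 : ℝ)) (X ω, ρ ω) * (ξ ω * c (ρ ω)) ∂P = 0 := by
  set φ : (α × ℝ) × β → ℝ := fun p => T.indicator (fun _ => (1 : ℝ)) (p.1.1, p.2) *
    (p.1.2 * c p.2) with hφ
  have hφm : Measurable φ :=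
    ((measurable_const.indicator hT).comp (by fun_prop)).mul (by fun_prop)
  have hpair : Measurable fun ω => (X ω, ξ ω) := hX.prodMk hξ
  have hmap := (indepFun_iff_map_prod_eq_prod_map_map hpair.aemeasurable hρ.aemeasurable).1 hind
  have h1 : ∫ ω, T.indicator (fun _ => (1 : ℝ)) (X ω, ρ ω) * (ξ ω * c (ρ ω)) ∂P
      = ∫ p, φ p ∂((P.map fun ω => (X ω, ξ ω)).prod (P.map ρ)) := by
    rw [← hmap, integral_map (hpair.prodMk hρ).aemeasurable hφm.aestronglyMeasurable]
  have := Measure.isProbabilityMeasure_map (μ := P) hpair.aemeasurable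
  have := Measure.isProbabilityMeasure_map (μ := P) hρ.aemeasurable
  rw [h1]
  by_cases hint : Integrable φ ((P.map fun ω => (X ω, ξ ω)).prod (P.map ρ))
  · rw [integral_prod_symm _ hint]
    refine integral_eq_zero_of_ae (Eventually.of_forall fun r => ?_)
    have hS : MeasurableSet {x | (x, r) ∈ T} := hT.preimage (by fun_prop)
    have h2 : ∫ p, φ (p, r) ∂(P.map fun ω => (X ω, ξ ω))
        = ∫ ω, (X ⁻¹' {x | (x, r) ∈ T}).indicator ξ ω * c r ∂P := by
      have hφr : Measurable fun p => φ (p, r) := hφm.comp measurable_prodMk_right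
      rw [integral_map hpair.aemeasurable hφr.aestronglyMeasurable]
      refine integral_congr_ae (Eventually.of_forall fun ω => ?_)
      by_cases h : (X ω, r) ∈ T <;> simp [hφ, Set.indicator, h]
    beta_reduce
    rw [Pi.zero_apply, h2, integral_mul_const, integral_indicator (hX hS), horth _ hS, zero_mul]
  · exact integral_undef hint

variable {E : Type*} [MeasurableSpace E] {N : ℕ} {W : Fin N → Ω → E} {ξ : Fin N → Ω → ℝ}

/-- The noise variables of two different units are orthogonal, even after restriction to an event
that is determined by the features. -/
theorem integral_indicator_mul_noise_eq_zero (hW : ∀ i, Measurable (W i))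
    (hξ : ∀ i, Measurable (ξ i)) (hind : iIndepFun (fun i ω => (W i ω, ξ i ω)) P)
    (horth : ∀ i S, MeasurableSet S → ∫ ω in W i ⁻¹' S, ξ i ω ∂P = 0)
    {D : Set (Fin N → E)} (hD : MeasurableSet D) {l l' : Fin N} (hl : l ≠ l') :
    ∫ ω, D.indicator (fun _ => (1 : ℝ)) (fun i => W i ω) * (ξ l ω * ξ l' ω) ∂P = 0 := by
  classical
  -- the features of all units are recovered from `W l` and the data `ρ` of the other units
  set R : Finset (Fin N) := Finset.univ.erase l with hR
  have hmem : ∀ i, i ∈ R ↔ i ≠ l := by simp [hR]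
  have hl' : l' ∈ R := (hmem l').2 hl.symm
  let ρ : Ω → R → E × ℝ := fun ω i => (W i ω, ξ i ω)
  let join : E × (R → E × ℝ) → Fin N → E := fun p i =>
    if h : i ∈ R then (p.2 ⟨i, h⟩).1 else p.1
  have hjoin : Measurable join := by
    refine measurable_pi_lambda _ fun i => ?_
    by_cases h : i ∈ R
    · simp only [join, h, dite_true]; fun_prop
    · simp only [join, h, dite_false]; fun_prop
  have hpair : ∀ i, Measurable fun ω => (W i ω, ξ i ω) := fun i => (hW i).prodMk (hξ i)
  have hρ : Measurable ρ := measurable_pi_lambda _ fun i => hpair i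
  have hi : IndepFun (fun ω => (W l ω, ξ l ω)) ρ P := by
    have := hind.indepFun_finset {l} R (by simp [hR]) hpair
    exact this.comp (φ := fun x : (({l} : Finset (Fin N)) → E × ℝ) => x ⟨l, by simp⟩)
      (ψ := id) (by fun_prop) measurable_id
  have := integral_indicator_mul_eq_zero (hW l) (hξ l) hρ hi (horth l) (hjoin hD)
    (c := fun r => (r ⟨l', hl'⟩).2) (by fun_prop)
  rw [← this]
  refine integral_congr_ae (Eventually.of_forall fun ω => ?_)
  have hrec : join (W l ω, ρ ω) = fun i => W i ω := by
    funext i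
    by_cases h : i ∈ R
    · simp [join, h, ρ]
    · simp only [join, h, dite_false]
      rw [hmem, not_not] at h
      rw [h]
  simp only [ρ] at hrec ⊢
  simp only [Set.indicator, Set.mem_preimage, hrec]

/-- The variance of a sum of noise variables, selected by a rule that depends on the features
only, is the sum of the variances. -/
theorem integral_sq_sum_selected (hW : ∀ i, Measurable (W i))
    (hξ : ∀ i, Measurable (ξ i)) (hξ2 : ∀ i, MemLp (ξ i) 2 P)
    (hind : iIndepFun (fun i ω => (W i ω, ξ i ω)) P)
    (horth : ∀ i S, MeasurableSet S → ∫ ω in W i ⁻¹' S, ξ i ω ∂P = 0)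
    (s : (Fin N → E) → Finset (Fin N)) (hs : ∀ l, MeasurableSet {w | l ∈ s w}) :
    ∫ ω, (∑ l ∈ s (fun i => W i ω), ξ l ω) ^ 2 ∂P
      = ∫ ω, ∑ l ∈ s (fun i => W i ω), ξ l ω ^ 2 ∂P := by
  classical
  let D : Fin N → Fin N → Set (Fin N → E) := fun l l' => {w | l ∈ s w} ∩ {w | l' ∈ s w}
  have hD : ∀ l l', MeasurableSet (D l l') := fun l l' => (hs l).inter (hs l')
  have hWall : Measurable fun ω => fun i => W i ω := measurable_pi_lambda _ hW
  have hmul : ∀ l l', Integrable (fun ω => (D l l').indicator (fun _ => (1 : ℝ))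
      (fun i => W i ω) * (ξ l ω * ξ l' ω)) P := by
    intro l l'
    have h := ((hξ2 l).integrable_mul (hξ2 l')).indicator (hWall (hD l l'))
    refine h.congr (Eventually.of_forall fun ω => ?_)
    by_cases hω : (fun i => W i ω) ∈ D l l' <;> simp [Set.indicator, hω]
  have hsq : ∀ ω, (∑ l ∈ s (fun i => W i ω), ξ l ω) ^ 2
      = ∑ l, ∑ l', (D l l').indicator (fun _ => (1 : ℝ)) (fun i => W i ω) * (ξ l ω * ξ l' ω) := by
    intro ω
    rw [pow_two, Finset.sum_mul_sum, ← Finset.sum_filter_add_sum_filter_not Finset.univ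
      (fun l => l ∈ s fun i => W i ω), Finset.filter_mem_eq_inter, Finset.univ_inter]
    rw [Finset.sum_eq_zero (s := Finset.univ.filter fun l => ¬ l ∈ s fun i => W i ω), add_zero]
    · refine Finset.sum_congr rfl fun l hl => ?_
      rw [← Finset.sum_filter_add_sum_filter_not Finset.univ
        (fun l => l ∈ s fun i => W i ω), Finset.filter_mem_eq_inter, Finset.univ_inter]
      rw [Finset.sum_eq_zero (s := Finset.univ.filter fun l => ¬ l ∈ s fun i => W i ω), add_zero]
      · refine Finset.sum_congr rfl fun l' hl' => ?_
        simp [D, hl, hl']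
      · intro l' hl'
        simp [D, (Finset.mem_filter.1 hl').2]
    · intro l hl
      simp [D, (Finset.mem_filter.1 hl).2]
  have hdiag : ∀ ω, ∑ l ∈ s (fun i => W i ω), ξ l ω ^ 2
      = ∑ l, (D l l).indicator (fun _ => (1 : ℝ)) (fun i => W i ω) * (ξ l ω * ξ l ω) := by
    intro ω
    simp only [D, Set.inter_self, Set.indicator, Set.mem_ofPred_eq, ite_mul, one_mul, zero_mul,
      Finset.sum_ite_mem, Finset.univ_inter, pow_two]
  simp_rw [hsq, hdiag]
  rw [integral_finsetSum _ fun l _ => integrable_finsetSum _ fun l' _ => hmul l l',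
    integral_finsetSum _ fun l _ => hmul l l]
  refine Finset.sum_congr rfl fun l _ => ?_
  rw [integral_finsetSum _ fun l' _ => hmul l l']
  exact Finset.sum_eq_single l (fun l' _ hl' =>
    integral_indicator_mul_noise_eq_zero hW hξ hind horth (hD l l') hl'.symm) (by simp)

end Noise

/-! ### Measurability of the estimator -/

section Measurability

variable {E : Type*} [NormedAddCommGroup E] {N : ℕ}

/-- A sum over neighbours as a sum of terms cut off to the events that they are selected. -/
theorem sum_nearest_eq_sum_indicator {α : Type*} (k : ℕ) (W : α → Fin N → E) (Y : Fin N → α → ℝ)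
    (x : α → E) (a : α) : ∑ l ∈ nearest k (W a) (x a), Y l a
      = ∑ l, {a | l ∈ nearest k (W a) (x a)}.indicator (Y l) a := by
  classical
  have h : ∀ l, {a | l ∈ nearest k (W a) (x a)}.indicator (Y l) a
      = if l ∈ nearest k (W a) (x a) then Y l a else 0 := by
    intro l
    by_cases h : l ∈ nearest k (W a) (x a) <;> simp [h]
  simp_rw [h, Finset.sum_ite_mem, Finset.univ_inter]

variable [MeasurableSpace E] [BorelSpace E] [SecondCountableTopology E]

theorem measurableSet_mem_nearest {α : Type*} [MeasurableSpace α] (k : ℕ) {W : α → Fin N → E}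
    {x : α → E} (hW : ∀ i, Measurable fun a => W a i) (hx : Measurable x) (l : Fin N) :
    MeasurableSet {a | l ∈ nearest k (W a) (x a)} := by
  simp_rw [mem_nearest, Finset.card_filter]
  refine measurableSet_lt (Finset.measurable_sum _ fun i _ => ?_) measurable_const
  refine Measurable.ite ?_ measurable_const measurable_const
  by_cases h : i = l
  · simp [h]
  · simp only [ne_eq, h, not_false_eq_true, true_and]
    exact measurableSet_lt ((hW i).sub hx).norm ((hW l).sub hx).norm

theorem memLp_kNN {Ω : Type*} [MeasurableSpace Ω] {P : Measure Ω} (k : ℕ) {W : Ω → Fin N → E}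
    {Y : Fin N → Ω → ℝ} {x : Ω → E} (hW : ∀ i, Measurable fun a => W a i)
    (hY : ∀ l, MemLp (Y l) 2 P) (hx : Measurable x) :
    MemLp (fun a => kNN k (W a) (fun l => Y l a) (x a)) 2 P := by
  simp_rw [kNN, sum_nearest_eq_sum_indicator]
  exact (memLp_finsetSum _ fun l _ =>
    (hY l).indicator (measurableSet_mem_nearest k hW hx l)).const_mul _

end Measurability

/-! ### Noise and bias of the in-sample estimates -/

section Consistency

variable {Ω : Type*} [MeasurableSpace Ω] {P : Measure Ω} [IsProbabilityMeasure P]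
  {E : Type*} [NormedAddCommGroup E] [MeasurableSpace E] [BorelSpace E]
  [SecondCountableTopology E]

/-- The noise part of the in-sample `k`-nearest-neighbour estimates is of order `1 / k`. -/
theorem sum_integral_sq_kNN_noise_le {N k γ : ℕ} (hk : 0 < k) {W : Fin N → Ω → E}
    {ξ : Fin N → Ω → ℝ} (hW : ∀ i, Measurable (W i)) (hξ : ∀ i, Measurable (ξ i))
    (hξ2 : ∀ i, MemLp (ξ i) 2 P) (hind : iIndepFun (fun i ω => (W i ω, ξ i ω)) P)
    (horth : ∀ i S, MeasurableSet S → ∫ ω in W i ⁻¹' S, ξ i ω ∂P = 0)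
    (hγ : ∀ᵐ ω ∂P, ∀ l : Fin N,
      (Finset.card {i : Fin N | l ∈ nearest k (fun i => W i ω) (W i ω)}) ≤ γ * k) :
    ∑ i, ∫ ω, kNN k (fun l => W l ω) (fun l => ξ l ω) (W i ω) ^ 2 ∂P
      ≤ γ / k * ∑ l, ∫ ω, ξ l ω ^ 2 ∂P := by
  classical
  have hk' : (0 : ℝ) < k := by exact_mod_cast hk
  have hsq : ∀ l, Integrable (fun ω => ξ l ω ^ 2) P := fun l => (hξ2 l).integrable_sq
  have hsel : ∀ i l, MeasurableSet {ω | l ∈ nearest k (fun i => W i ω) (W i ω)} := fun i l =>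
    measurableSet_mem_nearest k hW (hW i) l
  have hint : ∀ i, Integrable
      (fun ω => ∑ l ∈ nearest k (fun i => W i ω) (W i ω), ξ l ω ^ 2) P := by
    intro i
    simp_rw [sum_nearest_eq_sum_indicator k (fun ω i => W i ω) (fun l ω => ξ l ω ^ 2) (W i)]
    exact integrable_finsetSum _ fun l _ => (hsq l).indicator (hsel i l)
  have h1 : ∀ i, ∫ ω, kNN k (fun l => W l ω) (fun l => ξ l ω) (W i ω) ^ 2 ∂P
      = (1 / (k : ℝ)) ^ 2 *
        ∫ ω, ∑ l ∈ nearest k (fun i => W i ω) (W i ω), ξ l ω ^ 2 ∂P := by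
    intro i
    simp_rw [kNN, mul_pow]
    rw [integral_const_mul, integral_sq_sum_selected hW hξ hξ2 hind horth
      (fun w => nearest k w (w i))
      (measurableSet_mem_nearest k (fun i => measurable_pi_apply i) (measurable_pi_apply i))]
  simp_rw [h1]
  rw [← Finset.mul_sum, ← integral_finsetSum _ fun i _ => hint i,
    ← integral_finsetSum _ fun l _ => hsq l]
  have h2 : ∫ ω, ∑ i, ∑ l ∈ nearest k (fun i => W i ω) (W i ω), ξ l ω ^ 2 ∂P
      ≤ ∫ ω, γ * k * ∑ l, ξ l ω ^ 2 ∂P := by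
    refine integral_mono_ae (integrable_finsetSum _ fun i _ => hint i)
      ((integrable_finsetSum _ fun l _ => hsq l).const_mul _) ?_
    filter_upwards [hγ] with ω hω
    exact sum_sum_nearest_le hω fun l => sq_nonneg _
  rw [integral_const_mul] at h2
  calc (1 / (k : ℝ)) ^ 2 * _ ≤ (1 / (k : ℝ)) ^ 2 * _ :=
        mul_le_mul_of_nonneg_left h2 (by positivity)
    _ = _ := by field_simp

/-- The bias part of the in-sample `k`-nearest-neighbour estimates, in terms of the distance from
the regression function `f` to a bounded uniformly continuous `g`. -/
theorem sum_integral_sq_kNN_bias_le {N k γ : ℕ} (hk : 0 < k) {W : Fin N → Ω → E}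
    {ν : Measure E} (hW : ∀ i, Measurable (W i)) (hν : ∀ i, P.map (W i) = ν)
    (hcard : ∀ᵐ ω ∂P, ∀ i, (nearest k (fun l => W l ω) (W i ω)).card = k)
    (hγ : ∀ᵐ ω ∂P, ∀ l : Fin N,
      (Finset.card {i : Fin N | l ∈ nearest k (fun i => W i ω) (W i ω)}) ≤ γ * k)
    {B : Set E} (hB : MeasurableSet B) {δ : ℝ} {M : ℕ}
    (hM : ∀ (w : Fin N → E) (T : Finset (Fin N)),
      (∀ i ∈ T, w i ∈ B ∧ ∃ l ∈ nearest k w (w i), δ ≤ ‖w l - w i‖) → T.card ≤ M * k)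
    {f : E → ℝ} (hf : MemLp f 2 ν) {g : E → ℝ} (hg2 : MemLp g 2 ν)
    {C η : ℝ} (hC : ∀ x, |g x| ≤ C) (hg : ∀ x y, ‖y - x‖ < δ → |g x - g y| ≤ η) :
    ∑ i, ∫ ω, (f (W i ω) - kNN k (fun l => W l ω) (fun l => f (W l ω)) (W i ω)) ^ 2 ∂P
      ≤ N * (3 * (1 + γ) * ∫ x, (f x - g x) ^ 2 ∂ν
        + 3 * (η ^ 2 + (2 * C) ^ 2 * (M * (k / N) + ν.real Bᶜ))) := by
  rcases Nat.eq_zero_or_pos N with rfl | hN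
  · simp
  have hN' : (0 : ℝ) < N := by exact_mod_cast hN
  have hcomp : ∀ {h : E → ℝ} (i : Fin N), MemLp h 2 ν → MemLp (fun ω => h (W i ω)) 2 P :=
    fun i hh => MemLp.comp_of_map (by rwa [hν i]) (hW i).aemeasurable
  have hL : ∀ i, Integrable (fun ω =>
      (f (W i ω) - kNN k (fun l => W l ω) (fun l => f (W l ω)) (W i ω)) ^ 2) P := fun i =>
    ((hcomp i hf).sub (memLp_kNN k (Y := fun l ω => f (W l ω)) hW
      (fun l => hcomp l hf) (hW i))).integrable_sq
  have hfg : ∀ i, Integrable (fun ω => (f (W i ω) - g (W i ω)) ^ 2) P := fun i =>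
    ((hcomp i hf).sub (hcomp i hg2)).integrable_sq
  have hBm : Measurable (Bᶜ.indicator fun _ => (1 : ℝ)) := measurable_const.indicator hB.compl
  have hBi : ∀ i, Integrable (fun ω => Bᶜ.indicator (fun _ => (1 : ℝ)) (W i ω)) P := fun i =>
    (integrable_const (1 : ℝ)).indicator (hW i hB.compl)
  have hBint : ∀ i, ∫ ω, Bᶜ.indicator (fun _ => (1 : ℝ)) (W i ω) ∂P = ν.real Bᶜ := by
    intro i
    rw [← hν i, ← integral_map (hW i).aemeasurable hBm.aestronglyMeasurable,
      integral_indicator hB.compl]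
    simp
  have hfgint : ∀ i, ∫ ω, (f (W i ω) - g (W i ω)) ^ 2 ∂P = ∫ x, (f x - g x) ^ 2 ∂ν := by
    intro i
    rw [← hν i, integral_map (hW i).aemeasurable]
    rw [hν i]
    exact ((hf.sub hg2).integrable_sq).aestronglyMeasurable
  rw [← integral_finsetSum _ fun i _ => hL i]
  have hsumfg := integrable_finsetSum Finset.univ fun i _ => hfg i
  have hsumB := integrable_finsetSum Finset.univ fun i _ => hBi i
  have hsumB' : Integrable (fun ω => (M * k : ℝ) +
      ∑ i, Bᶜ.indicator (fun _ => (1 : ℝ)) (W i ω)) P := (integrable_const _).add hsumB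
  have hsum2 : Integrable (fun ω => N * η ^ 2 + (2 * C) ^ 2 * ((M * k : ℝ) +
      ∑ i, Bᶜ.indicator (fun _ => (1 : ℝ)) (W i ω))) P :=
    (integrable_const _).add (hsumB'.const_mul _)
  have hmono := integral_mono_ae (integrable_finsetSum Finset.univ fun i _ => hL i)
    ((hsumfg.const_mul (3 * (1 + (γ : ℝ)))).add
    (hsum2.const_mul 3))
    (by
      filter_upwards [hcard, hγ] with ω h1 h2
      exact sum_sq_sub_kNN_le hk h1 h2 (fun T hT => hM _ T hT) f hC hg)
  refine hmono.trans (le_of_eq ?_)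
  simp only [Pi.add_apply]
  rw [integral_add (hsumfg.const_mul _)
      (hsum2.const_mul _),
    integral_const_mul, integral_const_mul, integral_add (integrable_const _)
      (hsumB'.const_mul _), integral_const_mul ((2 * C) ^ 2),
    integral_add (integrable_const _) hsumB, integral_finsetSum _ fun i _ => hfg i,
    integral_finsetSum _ fun i _ => hBi i]
  simp only [hBint, hfgint, integral_const, probReal_univ, Finset.sum_const, Finset.card_univ,
    Fintype.card_fin, nsmul_eq_mul, smul_eq_mul]
  field_simp

end Consistency

/-! ### Universal consistency in sample -/

section Stone

variable {Ω : Type*} [MeasurableSpace Ω] {P : Measure Ω} [IsProbabilityMeasure P]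
  {E : Type*} [NormedAddCommGroup E] [InnerProductSpace ℝ E] [FiniteDimensional ℝ E]
  [MeasurableSpace E] [BorelSpace E]

/-- **Universal consistency of nearest neighbours, in sample.** If the pairs `(W i, Y i)` are
independent, the features `W i` have a common law `ν` without ties and `f` is the regression
function, then the mean squared errors of the `k`-nearest-neighbour estimates of `f (W i)`,
averaged over the sample points themselves, tend to zero. -/
theorem tendsto_avg_integral_sq_kNN_sub {W : ℕ → Ω → E} {Y : ℕ → Ω → ℝ} {ν : Measure E}
    (hW : ∀ i, Measurable (W i)) (hY : ∀ i, Measurable (Y i))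
    (hind : iIndepFun (fun i ω => (W i ω, Y i ω)) P) (hν : ∀ i, P.map (W i) = ν)
    {f : E → ℝ} (hfm : Measurable f) (hf : MemLp f 2 ν)
    (hξ2 : ∀ i, MemLp (fun ω => Y i ω - f (W i ω)) 2 P) {V : ℝ}
    (hV : ∀ i, ∫ ω, (Y i ω - f (W i ω)) ^ 2 ∂P ≤ V)
    (horth : ∀ i S, MeasurableSet S → ∫ ω in W i ⁻¹' S, (Y i ω - f (W i ω)) ∂P = 0)
    (hties : ∀ i i₁ i₂, i₁ ≠ i₂ → ∀ᵐ ω ∂P, ‖W i₁ ω - W i ω‖ ≠ ‖W i₂ ω - W i ω‖)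
    {k : ℕ → ℕ} (hk : Tendsto k atTop atTop)
    (hkN : Tendsto (fun N : ℕ => (k N : ℝ) / (N : ℝ)) atTop (𝓝 0)) :
    Tendsto (fun N : ℕ => (1 / (N : ℝ)) * ∑ i : Fin N, ∫ ω, (f (W i ω) -
      kNN (k N) (fun l : Fin N => W l ω) (fun l : Fin N => Y l ω) (W i ω)) ^ 2 ∂P)
      atTop (𝓝 0) := by
  have : IsProbabilityMeasure ν := hν 0 ▸ Measure.isProbabilityMeasure_map (hW 0).aemeasurable
  obtain ⟨γ, hγ⟩ := exists_card_nearest_inverse_le (E := E)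
  have hties' : ∀ᵐ ω ∂P, ∀ i i₁ i₂, i₁ ≠ i₂ → ‖W i₁ ω - W i ω‖ ≠ ‖W i₂ ω - W i ω‖ := by
    simp_rw [ae_all_iff]
    exact hties
  have hV0 : 0 ≤ V := (integral_nonneg fun ω => sq_nonneg _).trans (hV 0)
  have hcomp : ∀ i, MemLp (fun ω => f (W i ω)) 2 P := fun i =>
    MemLp.comp_of_map (by rwa [hν i]) (hW i).aemeasurable
  -- the two parts of the error, for an admissible number of neighbours
  have hbound : ∀ N k : ℕ, 0 < k → k ≤ N → ∀ (B : Set E) (δ : ℝ) (M : ℕ) (g : E → ℝ) (C η : ℝ),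
      MeasurableSet B → (∀ (w : Fin N → E) (T : Finset (Fin N)),
        (∀ i ∈ T, w i ∈ B ∧ ∃ l ∈ nearest k w (w i), δ ≤ ‖w l - w i‖) → T.card ≤ M * k) →
      MemLp g 2 ν → (∀ x, |g x| ≤ C) → (∀ x y, ‖y - x‖ < δ → |g x - g y| ≤ η) →
      (1 / (N : ℝ)) * ∑ i : Fin N, ∫ ω, (f (W i ω) -
        kNN k (fun l : Fin N => W l ω) (fun l : Fin N => Y l ω) (W i ω)) ^ 2 ∂P
        ≤ 2 * (γ * V * (k : ℝ)⁻¹) + 2 * (3 * (1 + γ) * ∫ x, (f x - g x) ^ 2 ∂ν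
          + 3 * (η ^ 2 + (2 * C) ^ 2 * (M * (k / N) + ν.real Bᶜ))) := by
    intro N k hk0 hkN B δ M g C η hB hM hg2 hC hg
    have hk' : (0 : ℝ) < k := by exact_mod_cast hk0
    have hN' : (0 : ℝ) < N := by exact_mod_cast hk0.trans_le hkN
    have hcard : ∀ᵐ ω ∂P, ∀ i : Fin N,
        (nearest k (fun l : Fin N => W l ω) (W i ω)).card = k := by
      filter_upwards [hties'] with ω hω i
      exact card_nearest_eq hkN fun i₁ i₂ h => hω i i₁ i₂ (by rwa [ne_eq, Fin.val_inj])
    have hinv : ∀ᵐ ω ∂P, ∀ l : Fin N, (Finset.card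
        {i : Fin N | l ∈ nearest k (fun i : Fin N => W i ω) (W i ω)}) ≤ γ * k := by
      filter_upwards [hties'] with ω hω
      refine hγ N k (fun i : Fin N => W i ω) fun i₁ i₂ h => ?_
      by_contra hne
      refine hω i₁ i₁ i₂ (by rwa [ne_eq, Fin.val_inj]) ?_
      dsimp only at h
      rw [h]
    have hξm : ∀ i, Measurable fun ω => Y i ω - f (W i ω) := fun i =>
      (hY i).sub (hfm.comp (hW i))
    have hnoise := sum_integral_sq_kNN_noise_le (P := P) (γ := γ) hk0
      (W := fun i : Fin N => W i) (ξ := fun (i : Fin N) ω => Y i ω - f (W i ω))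
      (fun i => hW i) (fun i => hξm i) (fun i => hξ2 i)
      ((hind.comp (fun _ p => (p.1, p.2 - f p.1)) (fun _ => by fun_prop)).precomp
        Fin.val_injective) (fun i => horth i) hinv
    have hbias := sum_integral_sq_kNN_bias_le (P := P) hk0 (W := fun i : Fin N => W i)
      (fun i => hW i) (fun i => hν i) hcard hinv hB hM hf hg2 hC hg
    have hnoise' : ∑ l : Fin N, ∫ ω, (Y l ω - f (W l ω)) ^ 2 ∂P ≤ N * V := by
      calc ∑ l : Fin N, ∫ ω, (Y l ω - f (W l ω)) ^ 2 ∂P ≤ ∑ _l : Fin N, V :=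
            Finset.sum_le_sum fun l _ => hV l
        _ = N * V := by simp
    have hsplit : ∀ i : Fin N, ∫ ω, (f (W i ω) -
        kNN k (fun l : Fin N => W l ω) (fun l : Fin N => Y l ω) (W i ω)) ^ 2 ∂P
        ≤ 2 * ∫ ω, kNN k (fun l : Fin N => W l ω)
            (fun l : Fin N => Y l ω - f (W l ω)) (W i ω) ^ 2 ∂P
          + 2 * ∫ ω, (f (W i ω) - kNN k (fun l : Fin N => W l ω)
            (fun l : Fin N => f (W l ω)) (W i ω)) ^ 2 ∂P := by
      intro i
      have e1 : Integrable (fun ω => kNN k (fun l : Fin N => W l ω)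
          (fun l : Fin N => Y l ω - f (W l ω)) (W i ω) ^ 2) P :=
        (memLp_kNN k (W := fun ω (l : Fin N) => W l ω)
          (Y := fun (l : Fin N) ω => Y l ω - f (W l ω))
          (fun l => hW l) (fun l => hξ2 l) (hW i)).integrable_sq
      have e2 : Integrable (fun ω => (f (W i ω) - kNN k (fun l : Fin N => W l ω)
          (fun l : Fin N => f (W l ω)) (W i ω)) ^ 2) P :=
        ((hcomp i).sub (memLp_kNN k (W := fun ω (l : Fin N) => W l ω)
          (Y := fun (l : Fin N) ω => f (W l ω))
          (fun l => hW l) (fun l => hcomp l) (hW i))).integrable_sq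
      rw [← integral_const_mul, ← integral_const_mul, ← integral_add (e1.const_mul _)
        (e2.const_mul _)]
      refine integral_mono_of_nonneg (Eventually.of_forall fun ω => sq_nonneg _)
        ((e1.const_mul _).add (e2.const_mul _)) (Eventually.of_forall fun ω => ?_)
      have : kNN k (fun l : Fin N => W l ω) (fun l : Fin N => Y l ω) (W i ω)
          = kNN k (fun l : Fin N => W l ω) (fun l : Fin N => Y l ω - f (W l ω)) (W i ω)
            + kNN k (fun l : Fin N => W l ω) (fun l : Fin N => f (W l ω)) (W i ω) := by
        simp only [kNN, Finset.sum_sub_distrib]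
        ring
      simp only [this]
      nlinarith [sq_nonneg (kNN k (fun l : Fin N => W l ω)
        (fun l : Fin N => Y l ω - f (W l ω)) (W i ω) + (f (W i ω) -
          kNN k (fun l : Fin N => W l ω) (fun l : Fin N => f (W l ω)) (W i ω)))]
    rw [one_div, inv_mul_le_iff₀ hN']
    have hsum := Finset.sum_le_sum fun (i : Fin N) (_ : i ∈ Finset.univ) => hsplit i
    rw [Finset.sum_add_distrib, ← Finset.mul_sum, ← Finset.mul_sum] at hsum
    have hmul := mul_le_mul_of_nonneg_left hnoise' (show (0 : ℝ) ≤ γ / k by positivity)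
    have heq : (γ : ℝ) / k * (N * V) = N * (γ * V * (k : ℝ)⁻¹) := by ring
    rw [heq] at hmul
    rw [mul_add, mul_left_comm, mul_left_comm (N : ℝ) 2]
    linarith
  rw [Metric.tendsto_atTop']
  intro e he
  -- the approximation `g` of `f`, then the scale `δ`, the compact set `B` and its covering number
  obtain ⟨g, hgsupp, hgτ, hgc, hg2⟩ := MemLp.exists_hasCompactSupport_integral_rpow_sub_le
    (p := 2) two_pos (by simpa using hf)
    (show (0 : ℝ) < e / (36 * (1 + γ)) by positivity)
  have hg2' : MemLp g 2 ν := by simpa using hg2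
  have hgτ' : ∫ x, (f x - g x) ^ 2 ∂ν ≤ e / (36 * (1 + γ)) := by
    simpa [Real.norm_eq_abs, sq_abs] using hgτ
  obtain ⟨C, hC⟩ := hgc.bounded_above_of_compact_support hgsupp
  have hη : (0 : ℝ) < Real.sqrt (e / 36) := Real.sqrt_pos.2 (by positivity)
  obtain ⟨δ, hδ, hgδ⟩ := Metric.uniformContinuous_iff.1
    (hgsupp.uniformContinuous_of_continuous hgc) _ hη
  have hβ : 0 < e / (36 * ((2 * C) ^ 2 + 1)) := by positivity
  obtain ⟨B, hBc, hBν⟩ := isTightMeasureSet_iff_exists_isCompact_measure_compl_le.1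
    (isTightMeasureSet_singleton (μ := ν)) (ENNReal.ofReal (e / (36 * ((2 * C) ^ 2 + 1))))
    (by simpa using hβ)
  have hBν' : ν.real Bᶜ ≤ e / (36 * ((2 * C) ^ 2 + 1)) :=
    ENNReal.toReal_le_of_le_ofReal hβ.le (hBν ν rfl)
  obtain ⟨M, hM⟩ := exists_card_far_neighbour_le hBc.totallyBounded hδ
  have hlim : Tendsto (fun N : ℕ => 2 * (γ * V * (k N : ℝ)⁻¹)
      + 6 * ((2 * C) ^ 2 * (M * ((k N : ℝ) / N)))) atTop (𝓝 0) := by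
    have h1 : Tendsto (fun N : ℕ => (k N : ℝ)⁻¹) atTop (𝓝 0) :=
      tendsto_inv_atTop_zero.comp (tendsto_natCast_atTop_atTop.comp hk)
    have := ((h1.const_mul ((γ : ℝ) * V)).const_mul 2).add
      (((hkN.const_mul (M : ℝ)).const_mul ((2 * C) ^ 2)).const_mul 6)
    simpa using this
  have hev : ∀ᶠ N in atTop, 0 < k N ∧ k N ≤ N ∧ 2 * (γ * V * (k N : ℝ)⁻¹)
      + 6 * ((2 * C) ^ 2 * (M * ((k N : ℝ) / N))) < e / 3 := by
    filter_upwards [hk.eventually_gt_atTop 0, hkN.eventually_lt_const one_pos,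
      hlim.eventually_lt_const (show 0 < e / 3 by positivity), eventually_gt_atTop 0]
      with N h1 h2 h3 h4
    refine ⟨h1, ?_, h3⟩
    rw [div_lt_one (by exact_mod_cast h4)] at h2
    exact_mod_cast h2.le
  obtain ⟨N₀, hN₀⟩ := eventually_atTop.1 hev
  refine ⟨N₀, fun N hN => ?_⟩
  obtain ⟨h1, h2, h3⟩ := hN₀ N hN.le
  have hb := hbound N (k N) h1 h2 B δ M g C (Real.sqrt (e / 36)) hBc.measurableSet
    (hM N (k N)) hg2' (fun x => by simpa [Real.norm_eq_abs] using hC x) (fun x y hxy => by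
      have := hgδ (a := x) (b := y) (by rwa [dist_comm, dist_eq_norm])
      rw [Real.dist_eq] at this
      exact this.le)
  rw [Real.sq_sqrt (by positivity)] at hb
  have e1 : 3 * (1 + (γ : ℝ)) * ∫ x, (f x - g x) ^ 2 ∂ν ≤ e / 12 := by
    calc 3 * (1 + (γ : ℝ)) * ∫ x, (f x - g x) ^ 2 ∂ν
        ≤ 3 * (1 + (γ : ℝ)) * (e / (36 * (1 + γ))) := by gcongr
      _ = e / 12 := by field_simp; norm_num
  have e2 : (2 * C) ^ 2 * ν.real Bᶜ ≤ e / 36 := by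
    calc (2 * C) ^ 2 * ν.real Bᶜ ≤ ((2 * C) ^ 2 + 1) * (e / (36 * ((2 * C) ^ 2 + 1))) := by
          gcongr
          linarith
      _ = e / 36 := by field_simp
  rw [dist_zero_right, Real.norm_of_nonneg]
  · refine lt_of_le_of_lt hb ?_
    nlinarith
  · exact mul_nonneg (by positivity) (Finset.sum_nonneg fun i _ =>
      integral_nonneg fun ω => sq_nonneg _)

end Stone

/-! ### Measurability of the order statistics -/

section OrderStatistics

/-- The increasing rearrangement of a vector. -/
noncomputable def sortedVector {m : ℕ} (y : Fin m → ℝ) : EuclideanSpace ℝ (Fin m) :=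
  WithLp.toLp 2 (y ∘ Tuple.sort y)

/-- The sorting permutation takes finitely many values, each of them on a set described by
finitely many inequalities between coordinates. -/
theorem measurable_sortedVector {m : ℕ} : Measurable (sortedVector (m := m)) := by
  have hσ : ∀ σ : Equiv.Perm (Fin m), MeasurableSet {y : Fin m → ℝ | σ = Tuple.sort y} := by
    intro σ
    have : {y : Fin m → ℝ | σ = Tuple.sort y}
        = (⋂ a, ⋂ b, ⋂ (_ : a ≤ b), {y : Fin m → ℝ | y (σ a) ≤ y (σ b)}) ∩
          (⋂ a, ⋂ b, ⋂ (_ : a < b), {y : Fin m → ℝ | y (σ a) = y (σ b) → σ a < σ b}) := by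
      ext y
      simp [Tuple.eq_sort_iff, Monotone]
    rw [this]
    refine MeasurableSet.inter ?_ ?_
    · exact MeasurableSet.iInter fun a => MeasurableSet.iInter fun b => MeasurableSet.iInter
        fun _ => measurableSet_le (measurable_pi_apply _) (measurable_pi_apply _)
    · refine MeasurableSet.iInter fun a => MeasurableSet.iInter fun b => MeasurableSet.iInter
        fun _ => ?_
      by_cases h : σ a < σ b
      · simp [h]
      · simp only [h, imp_false]
        exact (measurableSet_eq_fun (f := fun y : Fin m → ℝ => y (σ a))
          (g := fun y => y (σ b)) (by fun_prop) (by fun_prop)).compl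
  refine (WithLp.measurable_toLp 2 (Fin m → ℝ)).comp (measurable_pi_lambda _ fun a => ?_)
  have : (fun y : Fin m → ℝ => (y ∘ Tuple.sort y) a)
      = fun y => ∑ σ : Equiv.Perm (Fin m),
        {y : Fin m → ℝ | σ = Tuple.sort y}.indicator (fun y => y (σ a)) y := by
    funext y
    rw [Finset.sum_eq_single (Tuple.sort y)]
    · simp
    · intro σ _ h
      simp [h]
    · simp
  rw [this]
  exact Finset.measurable_sum _ fun σ _ => (measurable_pi_apply _).indicator (hσ σ)

theorem measurable_removeNth {m : ℕ} (j : Fin (m + 1)) :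
    Measurable fun z : Fin (m + 1) → ℝ => j.removeNth z :=
  measurable_pi_lambda _ fun l => measurable_pi_apply (j.succAbove l)

theorem measurable_orderStats {m : ℕ} (j : Fin (m + 1)) :
    Measurable fun z : Fin (m + 1) → ℝ => orderStats z j :=
  measurable_sortedVector.comp (measurable_removeNth j)

end OrderStatistics

/-! ### Laws in the replicate model -/

section Laws

/-- Finite measures on `S × (Fin n → ℝ)` are determined by the boxes. -/
theorem measure_ext_of_boxes {S : Type*} [MeasurableSpace S] {n : ℕ}
    {ρ₁ ρ₂ : Measure (S × (Fin n → ℝ))} [IsFiniteMeasure ρ₁]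
    (h : ∀ (B : Set S) (C : Fin n → Set ℝ), MeasurableSet B → (∀ l, MeasurableSet (C l)) →
      ρ₁ (B ×ˢ Set.univ.pi C) = ρ₂ (B ×ˢ Set.univ.pi C)) : ρ₁ = ρ₂ := by
  have huniv : ρ₁ Set.univ = ρ₂ Set.univ := by
    have := h Set.univ (fun _ => Set.univ) .univ fun _ => .univ
    simpa using this
  have : IsFiniteMeasure ρ₂ := ⟨by simp [← huniv]⟩
  refine Measure.ext_prod fun {B T} hB hT => ?_
  have key : (ρ₁.restrict (B ×ˢ Set.univ)).map Prod.snd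
      = (ρ₂.restrict (B ×ˢ Set.univ)).map Prod.snd := by
    have happ : ∀ (ρ : Measure (S × (Fin n → ℝ))) (T : Set (Fin n → ℝ)), MeasurableSet T →
        (ρ.restrict (B ×ˢ Set.univ)).map Prod.snd T = ρ (B ×ˢ T) := by
      intro ρ T hT
      rw [Measure.map_apply measurable_snd hT, Measure.restrict_apply (measurable_snd hT)]
      congr 1
      ext p
      simp [and_comm]
    refine MeasureTheory.ext_of_generate_finite _ generateFrom_pi.symm isPiSystem_pi ?_ ?_
    · rintro _ ⟨C, hC, rfl⟩
      have hC' : ∀ l, MeasurableSet (C l) := fun l => hC l (Set.mem_univ l)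
      rw [happ _ _ (MeasurableSet.univ_pi hC'), happ _ _ (MeasurableSet.univ_pi hC')]
      exact h B C hB hC'
    · rw [happ _ _ .univ, happ _ _ .univ]
      simpa using h B (fun _ => Set.univ) hB fun _ => .univ
  have h' := congrArg (fun ρ : Measure (Fin n → ℝ) => ρ T) key
  simp only [Measure.map_apply measurable_snd hT,
    Measure.restrict_apply (measurable_snd hT)] at h'
  convert h' using 2 <;> (ext p; simp [and_comm])

variable {A Ω : Type*} [MeasurableSpace A] [MeasurableSpace Ω] {m : ℕ}
  {G : Measure (ℝ × A)} {F : Kernel (ℝ × A) ℝ} {P : Measure Ω}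
  {μ : ℕ → Ω → ℝ} {α : ℕ → Ω → A} {Z : ℕ → Fin (m + 1) → Ω → ℝ}

theorem ReplicateModel.measurable_unit (h : ReplicateModel G F P μ α Z) (i : ℕ) :
    Measurable fun ω => ((μ i ω, α i ω), fun j => Z i j ω) :=
  ((h.measurable_mean i).prodMk (h.measurable_nuisance i)).prodMk
    (measurable_pi_lambda _ fun j => h.measurable_replicate i j)

/-- Joint law of the latent pair, the held-out replicate and the other replicates. -/
theorem ReplicateModel.measure_heldOut (h : ReplicateModel G F P μ α Z) (i : ℕ)
    (j : Fin (m + 1)) {B : Set (ℝ × A)} {D : Set ℝ} {C : Fin m → Set ℝ} (hB : MeasurableSet B)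
    (hD : MeasurableSet D) (hC : ∀ l, MeasurableSet (C l)) :
    P {ω | (μ i ω, α i ω) ∈ B ∧ Z i j ω ∈ D ∧ ∀ l, Z i (j.succAbove l) ω ∈ C l}
      = ∫⁻ a in B, F a D * ∏ l, F a (C l) ∂G := by
  have := h.unit_law i B (j.insertNth D C) hB (fun l => by
    refine Fin.succAboveCases j ?_ (fun l => ?_) l
    · simpa using hD
    · simpa using hC l)
  simp only [Fin.prod_univ_succAbove _ j, Fin.insertNth_apply_same,
    Fin.insertNth_apply_succAbove, Fin.forall_iff_succAbove j] at this
  exact this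

variable [IsProbabilityMeasure P]

/-- All units have the same law. -/
theorem ReplicateModel.identDistrib_unit (h : ReplicateModel G F P μ α Z) (i i' : ℕ) :
    IdentDistrib (fun ω => ((μ i ω, α i ω), fun j => Z i j ω))
      (fun ω => ((μ i' ω, α i' ω), fun j => Z i' j ω)) P P := by
  refine ⟨(h.measurable_unit i).aemeasurable, (h.measurable_unit i').aemeasurable, ?_⟩
  have := Measure.isProbabilityMeasure_map (μ := P) (h.measurable_unit i).aemeasurable
  refine measure_ext_of_boxes fun B C hB hC => ?_
  have happ : ∀ i, P.map (fun ω => ((μ i ω, α i ω), fun j => Z i j ω)) (B ×ˢ Set.univ.pi C)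
      = ∫⁻ a in B, ∏ j, F a (C j) ∂G := by
    intro i
    rw [Measure.map_apply (h.measurable_unit i) (hB.prod (MeasurableSet.univ_pi hC)),
      ← h.unit_law i B C hB hC]
    congr 1
    ext ω
    simp
  rw [happ, happ]

variable [IsMarkovKernel F]

/-- The latent pair together with the replicates that remain after one has been held out has a
law that depends neither on the unit nor on the replicate held out. -/
theorem ReplicateModel.identDistrib_removeNth (h : ReplicateModel G F P μ α Z) (i i' : ℕ)
    (j j' : Fin (m + 1)) :
    IdentDistrib (fun ω => ((μ i ω, α i ω), j.removeNth fun l => Z i l ω))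
      (fun ω => ((μ i' ω, α i' ω), j'.removeNth fun l => Z i' l ω)) P P := by
  have hm : ∀ i (j : Fin (m + 1)),
      Measurable fun ω => ((μ i ω, α i ω), j.removeNth fun l => Z i l ω) := fun i j =>
    (measurable_fst.prodMk ((measurable_removeNth j).comp measurable_snd)).comp
      (h.measurable_unit i)
  refine ⟨(hm i j).aemeasurable, (hm i' j').aemeasurable, ?_⟩
  have := Measure.isProbabilityMeasure_map (μ := P) (hm i j).aemeasurable
  refine measure_ext_of_boxes fun B C hB hC => ?_
  have happ : ∀ i (j : Fin (m + 1)),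
      P.map (fun ω => ((μ i ω, α i ω), j.removeNth fun l => Z i l ω)) (B ×ˢ Set.univ.pi C)
      = ∫⁻ a in B, ∏ l, F a (C l) ∂G := by
    intro i j
    rw [Measure.map_apply (hm i j) (hB.prod (MeasurableSet.univ_pi hC))]
    have := h.measure_heldOut i j hB .univ hC
    simp only [measure_univ, one_mul] at this
    rw [← this]
    congr 1
    ext ω
    simp [Fin.removeNth]
  rw [happ, happ]

/-- On an event given by the other replicates, the held-out replicate and the latent mean have the
same integral: given the latent pair, the replicates are independent and have mean `μ`. -/
theorem ReplicateModel.setIntegral_heldOut_sub_mean [IsProbabilityMeasure G]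
    (h : ReplicateModel G F P μ α Z)
    (hμ : ∀ i, MemLp (μ i) 2 P) (hZ : ∀ i j, MemLp (Z i j) 2 P) (i : ℕ) (j : Fin (m + 1))
    {S : Set (Fin m → ℝ)} (hS : MeasurableSet S) :
    ∫ ω in (fun ω => j.removeNth fun l => Z i l ω) ⁻¹' S, (Z i j ω - μ i ω) ∂P = 0 := by
  have hr : Measurable fun ω => j.removeNth fun l => Z i l ω :=
    (measurable_removeNth j).comp (measurable_snd.comp (h.measurable_unit i))
  have hint : Integrable (fun ω => Z i j ω - μ i ω) P :=
    ((hZ i j).sub (hμ i)).integrable (by norm_num)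
  have hbox : ∀ C : Fin m → Set ℝ, (∀ l, MeasurableSet (C l)) →
      ∫ ω in (fun ω => j.removeNth fun l => Z i l ω) ⁻¹' (Set.univ.pi C),
        (Z i j ω - μ i ω) ∂P = 0 := by
    intro C hC
    set Q := P.restrict ((fun ω => j.removeNth fun l => Z i l ω) ⁻¹' (Set.univ.pi C)) with hQ
    have hw : Measurable fun a => ∏ l, F a (C l) :=
      Finset.measurable_prod _ fun l _ => F.measurable_coe (hC l)
    have hp : Measurable fun ω => ((μ i ω, α i ω), Z i j ω) :=
      ((h.measurable_mean i).prodMk (h.measurable_nuisance i)).prodMk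
        (h.measurable_replicate i j)
    have hlaw : Q.map (fun ω => ((μ i ω, α i ω), Z i j ω))
        = (G.withDensity fun a => ∏ l, F a (C l)) ⊗ₘ F := by
      have : IsFiniteMeasure (Q.map fun ω => ((μ i ω, α i ω), Z i j ω)) :=
        Measure.isFiniteMeasure_map _ _
      refine Measure.ext_prod fun {B D} hB hD => ?_
      rw [Measure.map_apply hp (hB.prod hD), hQ, Measure.restrict_apply (hp (hB.prod hD)),
        Measure.compProd_apply_prod hB hD,
        setLIntegral_withDensity_eq_setLIntegral_mul _ hw (F.measurable_coe hD) hB]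
      refine Eq.trans ?_ ((h.measure_heldOut i j hB hD hC).trans ?_)
      · congr 1
        ext ω
        simp [Fin.removeNth, and_assoc]
      · refine lintegral_congr fun a => ?_
        simp [mul_comm]
    have hsub : Measurable fun p : (ℝ × A) × ℝ => p.2 - p.1.1 := by fun_prop
    have hintQ : Integrable (fun p : (ℝ × A) × ℝ => p.2 - p.1.1)
        ((G.withDensity fun a => ∏ l, F a (C l)) ⊗ₘ F) := by
      rw [← hlaw, integrable_map_measure hsub.aestronglyMeasurable hp.aemeasurable]
      exact hint.restrict
    have hfin : IsFiniteMeasure (G.withDensity fun a => ∏ l, F a (C l)) := by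
      refine isFiniteMeasure_withDensity (ne_top_of_le_ne_top ENNReal.one_ne_top ?_)
      calc ∫⁻ a, ∏ l, F a (C l) ∂G ≤ ∫⁻ _, 1 ∂G :=
            lintegral_mono fun a => Finset.prod_le_one' fun l _ => prob_le_one
        _ = 1 := by simp
    calc ∫ ω, (Z i j ω - μ i ω) ∂Q
        = ∫ p, (p.2 - p.1.1) ∂(Q.map fun ω => ((μ i ω, α i ω), Z i j ω)) :=
          (integral_map hp.aemeasurable hsub.aestronglyMeasurable).symm
      _ = ∫ a, ∫ z, (z - a.1) ∂(F a) ∂(G.withDensity fun a => ∏ l, F a (C l)) := by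
          rw [hlaw, Measure.integral_compProd hintQ]
      _ = 0 := by
          refine integral_eq_zero_of_ae ?_
          filter_upwards [(withDensity_absolutelyContinuous G _).ae_le h.mean_eq] with a ha
          rw [integral_sub ha.1 (integrable_const _), ha.2]
          simp
  have hgen := (generateFrom_pi (ι := Fin m) (α := fun _ => ℝ)).symm
  have hpi := isPiSystem_pi (ι := Fin m) (α := fun _ => ℝ)
  induction S, hS using MeasurableSpace.induction_on_inter hgen hpi with
  | empty => simp
  | basic t ht =>
    obtain ⟨C, hC, rfl⟩ := ht
    exact hbox C fun l => hC l (Set.mem_univ l)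
  | compl t ht ih =>
    have huniv := hbox (fun _ => Set.univ) fun _ => .univ
    have hadd := integral_add_compl (hr ht) hint
    simp only [Set.pi_univ, Set.preimage_univ, Measure.restrict_univ] at huniv
    rw [ih, huniv, zero_add] at hadd
    exact hadd
  | iUnion f hd hf ih =>
    rw [Set.preimage_iUnion, integral_iUnion (fun n => hr (hf n))
      (fun a b hab => (hd hab).preimage _) hint.integrableOn]
    simp [ih]

end Laws

/-! ### Random tie-breaking -/

section TieBreaking

variable {Ω : Type*} [MeasurableSpace Ω] {P : Measure Ω}

/-- Two independent families, each of them independent, form an independent family of pairs. -/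
theorem iIndepFun_prodMk_of_indepFun {ι α β : Type*} [MeasurableSpace α] [MeasurableSpace β]
    {X : ι → Ω → α} {U : ι → Ω → β} (hX : ∀ i, Measurable (X i)) (hU : ∀ i, Measurable (U i))
    (hiX : iIndepFun X P) (hiU : iIndepFun U P)
    (h : IndepFun (fun ω i => U i ω) (fun ω i => X i ω) P) :
    iIndepFun (fun i ω => (X i ω, U i ω)) P := by
  classical
  let π : ι → Set (Set Ω) := fun i => {t | ∃ S : Set α, ∃ T : Set β, MeasurableSet S ∧
    MeasurableSet T ∧ t = (fun ω => (X i ω, U i ω)) ⁻¹' (S ×ˢ T)}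
  have hrect : ∀ (s : Finset ι) (S : ι → Set α) (T : ι → Set β), (∀ i, MeasurableSet (S i)) →
      (∀ i, MeasurableSet (T i)) → P (⋂ i ∈ s, (fun ω => (X i ω, U i ω)) ⁻¹' (S i ×ˢ T i))
        = ∏ i ∈ s, (P (X i ⁻¹' S i) * P (U i ⁻¹' T i)) := by
    intro s S T hS hT
    have hset : (⋂ i ∈ s, (fun ω => (X i ω, U i ω)) ⁻¹' (S i ×ˢ T i))
        = (fun ω i => U i ω) ⁻¹' (⋂ i ∈ s, (fun u => u i) ⁻¹' T i) ∩
          (fun ω i => X i ω) ⁻¹' (⋂ i ∈ s, (fun x => x i) ⁻¹' S i) := by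
      ext ω
      simp only [Set.mem_iInter, Set.mem_preimage, Set.mem_prod, Set.mem_inter_iff]
      exact ⟨fun h => ⟨fun i hi => (h i hi).2, fun i hi => (h i hi).1⟩,
        fun h i hi => ⟨h.2 i hi, h.1 i hi⟩⟩
    rw [hset, h.measure_inter_preimage_eq_mul _ _
      (Finset.measurableSet_biInter _ fun i _ => measurable_pi_apply i (hT i))
      (Finset.measurableSet_biInter _ fun i _ => measurable_pi_apply i (hS i))]
    simp only [Set.preimage_iInter, ← Set.preimage_comp]
    rw [Finset.prod_mul_distrib, mul_comm]
    congr 1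
    · exact hiX.measure_inter_preimage_eq_mul s fun i _ => hS i
    · exact hiU.measure_inter_preimage_eq_mul s fun i _ => hT i
  refine iIndepSets.iIndep (fun i => ((hX i).prodMk (hU i)).comap_le) π ?_ ?_ ?_
  · rintro i _ ⟨S, T, hS, hT, rfl⟩ _ ⟨S', T', hS', hT', rfl⟩ -
    exact ⟨S ∩ S', T ∩ T', hS.inter hS', hT.inter hT', by
      rw [← Set.preimage_inter, Set.prod_inter_prod]⟩
  · intro i
    rw [← generateFrom_prod, MeasurableSpace.comap_generateFrom]
    congr 1
    ext t
    constructor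
    · rintro ⟨_, ⟨S, hS, T, hT, rfl⟩, rfl⟩
      exact ⟨S, T, hS, hT, rfl⟩
    · rintro ⟨S, T, hS, hT, rfl⟩
      exact ⟨_, ⟨S, hS, T, hT, rfl⟩, rfl⟩
  · rw [iIndepSets_iff]
    intro s f hf
    choose! S T hS hT hfe using hf
    have hS' : ∀ i, MeasurableSet (if i ∈ s then S i else Set.univ) := fun i => by
      split_ifs with hi
      exacts [hS i hi, .univ]
    have hT' : ∀ i, MeasurableSet (if i ∈ s then T i else Set.univ) := fun i => by
      split_ifs with hi
      exacts [hT i hi, .univ]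
    have h1 : (⋂ i ∈ s, f i) = ⋂ i ∈ s, (fun ω => (X i ω, U i ω)) ⁻¹'
        ((if i ∈ s then S i else Set.univ) ×ˢ (if i ∈ s then T i else Set.univ)) :=
      Set.iInter₂_congr fun i hi => by rw [hfe i hi, if_pos hi, if_pos hi]
    rw [h1, hrect s _ _ hS' hT']
    refine Finset.prod_congr rfl fun i hi => ?_
    have h2 := hrect {i} _ _ hS' hT'
    simp only [Finset.mem_singleton, Set.iInter_iInter_eq_left, Finset.prod_singleton] at h2
    rw [← h2, if_pos hi, if_pos hi, hfe i hi]

variable [IsProbabilityMeasure P]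

/-- Independent points whose laws charge no sphere have no ties in their distances. -/
theorem ae_norm_sub_ne_of_sphere_null {E : Type*} [NormedAddCommGroup E] [MeasurableSpace E]
    [BorelSpace E] [SecondCountableTopology E] {W : ℕ → Ω → E} (hW : ∀ i, Measurable (W i))
    (hind : iIndepFun W P) (hsph : ∀ i (a : E) (r : ℝ), P.map (W i) {w | ‖w - a‖ = r} = 0)
    (i i₁ i₂ : ℕ) (hne : i₁ ≠ i₂) : ∀ᵐ ω ∂P, ‖W i₁ ω - W i ω‖ ≠ ‖W i₂ ω - W i ω‖ := by
  -- one of the two points is not the centre; the roles of `i₁` and `i₂` are symmetric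
  wlog h : i₁ ≠ i generalizing i₁ i₂
  · rw [not_not] at h
    subst h
    filter_upwards [this i₂ i₁ hne.symm hne.symm] with ω hω using hω.symm
  have hR : Measurable fun ω => (W i₂ ω, W i ω) := (hW i₂).prodMk (hW i)
  have hi : IndepFun (fun ω => (W i₂ ω, W i ω)) (W i₁) P := by
    have := hind.indepFun_finset {i₂, i} {i₁} (by simp [hne, h]) hW
    exact this.comp (φ := fun x : (({i₂, i} : Finset ℕ) → E) => (x ⟨i₂, by simp⟩, x ⟨i, by simp⟩))
      (ψ := fun x : (({i₁} : Finset ℕ) → E) => x ⟨i₁, by simp⟩) (by fun_prop) (by fun_prop)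
  have hmap := (indepFun_iff_map_prod_eq_prod_map_map hR.aemeasurable (hW i₁).aemeasurable).1 hi
  have := Measure.isProbabilityMeasure_map (μ := P) (hW i₁).aemeasurable
  set T : Set ((E × E) × E) := {p | ‖p.2 - p.1.2‖ = ‖p.1.1 - p.1.2‖} with hT
  have hTm : MeasurableSet T := measurableSet_eq_fun (by fun_prop) (by fun_prop)
  have hnull : P.map (fun ω => ((W i₂ ω, W i ω), W i₁ ω)) T = 0 := by
    rw [hmap, Measure.measure_prod_null hTm]
    exact Eventually.of_forall fun r => hsph i₁ r.2 ‖r.1 - r.2‖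
  rw [Measure.map_apply (hR.prodMk (hW i₁)) hTm] at hnull
  rw [ae_iff]
  simpa [hT] using hnull

/-- A vector with a further coordinate appended. -/
noncomputable def appendTie {m : ℕ} (x : EuclideanSpace ℝ (Fin m)) (u : ℝ) :
    EuclideanSpace ℝ (Fin (m + 1)) :=
  WithLp.toLp 2 (Fin.snoc (α := fun _ => ℝ) x u)

theorem orderStatsTie_eq_appendTie {m : ℕ} (z : Fin (m + 1) → ℝ) (j : Fin (m + 1)) (u : ℝ) :
    orderStatsTie z j u = appendTie (orderStats z j) u := rfl

theorem measurable_appendTie {m : ℕ} :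
    Measurable fun p : EuclideanSpace ℝ (Fin m) × ℝ => appendTie p.1 p.2 := by
  refine (WithLp.measurable_toLp 2 (Fin (m + 1) → ℝ)).comp (measurable_pi_lambda _ fun a => ?_)
  refine Fin.lastCases ?_ (fun a => ?_) a
  · simp only [Fin.snoc_last]
    exact measurable_snd
  · simp only [Fin.snoc_castSucc]
    fun_prop

theorem measurable_orderStatsTie {m : ℕ} (j : Fin (m + 1)) :
    Measurable fun p : (Fin (m + 1) → ℝ) × ℝ => orderStatsTie p.1 j p.2 :=
  measurable_appendTie.comp
    (((measurable_orderStats j).comp measurable_fst).prodMk measurable_snd)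

/-- Independent tie-breakers carry no information: a variable that is orthogonal to the functions
of `X` stays so after `U` is appended to `X`. -/
theorem setIntegral_appendTie_eq_zero {m : ℕ} {X : Ω → EuclideanSpace ℝ (Fin m)} {ξ U : Ω → ℝ}
    (hX : Measurable X) (hξ : Measurable ξ) (hU : Measurable U)
    (hind : IndepFun (fun ω => (X ω, ξ ω)) U P)
    (horth : ∀ S, MeasurableSet S → ∫ ω in X ⁻¹' S, ξ ω ∂P = 0)
    {S : Set (EuclideanSpace ℝ (Fin (m + 1)))} (hS : MeasurableSet S) :
    ∫ ω in (fun ω => appendTie (X ω) (U ω)) ⁻¹' S, ξ ω ∂P = 0 := by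
  have hm : Measurable fun ω => appendTie (X ω) (U ω) :=
    measurable_appendTie.comp (hX.prodMk hU)
  rw [← integral_indicator (hm hS), ← integral_indicator_mul_eq_zero hX hξ hU hind horth
    (measurable_appendTie hS) (c := fun _ => 1) measurable_const]
  refine integral_congr_ae (Eventually.of_forall fun ω => ?_)
  by_cases h : appendTie (X ω) (U ω) ∈ S <;> simp [Set.indicator, h]

/-- The features without the tie-breaking coordinate. -/
noncomputable def dropTie {m : ℕ} (w : EuclideanSpace ℝ (Fin (m + 1))) :
    EuclideanSpace ℝ (Fin m) :=
  WithLp.toLp 2 fun a => w a.castSucc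

theorem measurable_dropTie {m : ℕ} : Measurable (dropTie (m := m)) :=
  (WithLp.measurable_toLp 2 (Fin m → ℝ)).comp (measurable_pi_lambda _ fun a => by fun_prop)

theorem dropTie_orderStatsTie {m : ℕ} (z : Fin (m + 1) → ℝ) (j : Fin (m + 1)) (u : ℝ) :
    dropTie (orderStatsTie z j u) = orderStats z j := by
  ext a
  simp [dropTie, orderStatsTie_eq_appendTie, appendTie]

/-- A line in the direction of the tie-breaker meets a sphere in at most two points. -/
theorem finite_orderStatsTie_mem_sphere {m : ℕ} (z : Fin (m + 1) → ℝ) (j : Fin (m + 1))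
    (a : EuclideanSpace ℝ (Fin (m + 1))) (r : ℝ) :
    {u : ℝ | ‖orderStatsTie z j u - a‖ = r}.Finite := by
  set c : ℝ := r ^ 2 - ∑ l : Fin m, (orderStats z j l - a l.castSucc) ^ 2 with hc
  refine Set.Finite.subset (Set.toFinite
    {a (Fin.last m) + Real.sqrt c, a (Fin.last m) - Real.sqrt c}) fun u hu => ?_
  have h1 : (u - a (Fin.last m)) ^ 2 = c := by
    have h2 : ‖orderStatsTie z j u - a‖ ^ 2 = r ^ 2 := by rw [hu]
    rw [EuclideanSpace.norm_sq_eq, Fin.sum_univ_castSucc] at h2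
    simp only [orderStatsTie_eq_appendTie, appendTie, PiLp.sub_apply, Fin.snoc_castSucc,
      Fin.snoc_last, Real.norm_eq_abs, sq_abs] at h2
    rw [hc]
    linarith
  have h3 : |u - a (Fin.last m)| = Real.sqrt c := by rw [← h1, Real.sqrt_sq_eq_abs]
  rcases abs_choice (u - a (Fin.last m)) with h | h <;> rw [h] at h3
  · left; linarith
  · right; rw [Set.mem_singleton_iff]; linarith

/-- The law of order statistics with an independent atomless tie-breaker charges no sphere. -/
theorem map_orderStatsTie_sphere_eq_zero {m : ℕ} {z : Ω → Fin (m + 1) → ℝ} {u : Ω → ℝ}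
    (hz : Measurable z) (hu : Measurable u) (hind : IndepFun z u P) [NullSingletonClass (P.map u)]
    (j : Fin (m + 1)) (a : EuclideanSpace ℝ (Fin (m + 1))) (r : ℝ) :
    P.map (fun ω => orderStatsTie (z ω) j (u ω)) {w | ‖w - a‖ = r} = 0 := by
  have hmap := (indepFun_iff_map_prod_eq_prod_map_map hz.aemeasurable hu.aemeasurable).1 hind
  have := Measure.isProbabilityMeasure_map (μ := P) hu.aemeasurable
  have hm := measurable_orderStatsTie (m := m) j
  have hS : MeasurableSet {w : EuclideanSpace ℝ (Fin (m + 1)) | ‖w - a‖ = r} :=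
    measurableSet_eq_fun (by fun_prop) measurable_const
  have : P.map (fun ω => orderStatsTie (z ω) j (u ω))
      = (P.map fun ω => (z ω, u ω)).map fun p => orderStatsTie p.1 j p.2 :=
    (Measure.map_map hm (hz.prodMk hu)).symm
  rw [this, Measure.map_apply hm hS, hmap, Measure.measure_prod_null (hm hS)]
  exact Eventually.of_forall fun x => (finite_orderStatsTie_mem_sphere x j a r).measure_zero _

end TieBreaking

/-! ### Regression functions and averages -/

section Regression

variable {Ω : Type*} [MeasurableSpace Ω] {P : Measure Ω}

/-- A version of a regression function depends on the joint law only. -/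
theorem condExp_comap_eq_comp_of_identDistrib [IsProbabilityMeasure P] {β : Type*}
    [MeasurableSpace β] {X X' : Ω → β}
    {Y Y' : Ω → ℝ} (hX : Measurable X) (hX' : Measurable X') (hY : Integrable Y P)
    (h : IdentDistrib (fun ω => (Y ω, X ω)) (fun ω => (Y' ω, X' ω)) P P) {f : β → ℝ}
    (hf : Measurable f) (hfX : P[Y | MeasurableSpace.comap X inferInstance] =ᵐ[P] f ∘ X) :
    P[Y' | MeasurableSpace.comap X' inferInstance] =ᵐ[P] f ∘ X' := by
  have hfI : Integrable (f ∘ X) P := integrable_condExp.congr hfX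
  have hfI' : Integrable (f ∘ X') P :=
    (h.comp (hf.comp measurable_snd)).integrable_snd hfI
  have hY' : Integrable Y' P := (h.comp measurable_fst).integrable_snd hY
  refine (ae_eq_condExp_of_forall_setIntegral_eq hX'.comap_le hY' (fun s _ _ => hfI'.integrableOn)
    ?_ (hf.comp (comap_measurable X')).aestronglyMeasurable).symm
  rintro _ ⟨T, hT, rfl⟩ -
  have hTs : MeasurableSet (Prod.snd ⁻¹' T : Set (ℝ × β)) := measurable_snd hT
  have h1 : ∫ ω in X ⁻¹' T, (f ∘ X) ω ∂P = ∫ ω in X' ⁻¹' T, (f ∘ X') ω ∂P := by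
    rw [← integral_indicator (hX hT), ← integral_indicator (hX' hT)]
    exact (h.comp ((hf.comp measurable_snd).indicator hTs)).integral_eq
  have h2 : ∫ ω in X ⁻¹' T, Y ω ∂P = ∫ ω in X' ⁻¹' T, Y' ω ∂P := by
    rw [← integral_indicator (hX hT), ← integral_indicator (hX' hT)]
    exact (h.comp (measurable_fst.indicator hTs)).integral_eq
  rw [← h1, ← h2, ← setIntegral_condExp hX.comap_le hY ⟨T, hT, rfl⟩]
  exact setIntegral_congr_ae (hX hT) (hfX.mono fun ω hω _ => hω.symm)

/-- Jensen's inequality for the second moment of an average. -/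
theorem integral_sq_avg_le {n : ℕ} {a : Fin (n + 1) → Ω → ℝ} (ha : ∀ j, MemLp (a j) 2 P) :
    ∫ ω, ((1 / ((n + 1 : ℕ) : ℝ)) * ∑ j, a j ω) ^ 2 ∂P
      ≤ (1 / ((n + 1 : ℕ) : ℝ)) * ∑ j, ∫ ω, a j ω ^ 2 ∂P := by
  have hsum := integrable_finsetSum Finset.univ fun j _ => (ha j).integrable_sq
  rw [← integral_finsetSum _ fun j _ => (ha j).integrable_sq, ← integral_const_mul]
  refine integral_mono_of_nonneg (Eventually.of_forall fun ω => sq_nonneg _)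
    (hsum.const_mul _) (Eventually.of_forall fun ω => ?_)
  have h := sq_sum_le_card_mul_sum_sq (s := Finset.univ) (f := fun j => a j ω)
  rw [Finset.card_univ, Fintype.card_fin] at h
  have hn : (0 : ℝ) < ((n + 1 : ℕ) : ℝ) := by positivity
  simp only [mul_pow]
  calc (1 / ((n + 1 : ℕ) : ℝ)) ^ 2 * (∑ j, a j ω) ^ 2
      ≤ (1 / ((n + 1 : ℕ) : ℝ)) ^ 2 * (((n + 1 : ℕ) : ℝ) * ∑ j, a j ω ^ 2) := by gcongr
    _ = (1 / ((n + 1 : ℕ) : ℝ)) * ∑ j, a j ω ^ 2 := by field_simp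

end Regression

/-! ### From consistency to the risk of Aurora -/

section AveragedRegression

variable {Ω : Type*} [MeasurableSpace Ω] {P : Measure Ω}

/-- Estimates that differ from targets of constant risk `R` by an error whose average second
moment tends to zero have average mean squared errors that converge to `R`. -/
theorem tendsto_avgMSE_of_tendsto_avg_sq {μ a : ℕ → Ω → ℝ} {est : (N : ℕ) → Fin N → Ω → ℝ} {R : ℝ}
    (hμ : ∀ i, MemLp (μ i) 2 P) (ha : ∀ i, MemLp (a i) 2 P)
    (hest : ∀ N i, MemLp (est N i) 2 P) (hR : ∀ i, ∫ ω, (μ i ω - a i ω) ^ 2 ∂P = R)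
    (hd : Tendsto (fun N : ℕ => (1 / (N : ℝ)) * ∑ i : Fin N,
      ∫ ω, (a i ω - est N i ω) ^ 2 ∂P) atTop (𝓝 0)) :
    Tendsto (fun N => avgMSE P μ N (est N)) atTop (𝓝 R) := by
  have hR0 : 0 ≤ R := hR 0 ▸ integral_nonneg fun ω => sq_nonneg _
  have hA : ∀ i, Integrable (fun ω => (μ i ω - a i ω) ^ 2) P := fun i =>
    ((hμ i).sub (ha i)).integrable_sq
  have hD : ∀ N (i : Fin N), Integrable (fun ω => (a i ω - est N i ω) ^ 2) P := fun N i =>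
    ((ha i).sub (hest N i)).integrable_sq
  have hM : ∀ N (i : Fin N), Integrable (fun ω => (μ i ω - est N i ω) ^ 2) P := fun N i =>
    ((hμ i).sub (hest N i)).integrable_sq
  -- `|(x + y) ^ 2 - x ^ 2| ≤ s x ^ 2 + (1 + 1 / s) y ^ 2`
  have hone : ∀ s : ℝ, 0 < s → ∀ N (i : Fin N), |∫ ω, (μ i ω - est N i ω) ^ 2 ∂P - R|
      ≤ s * R + (1 + s⁻¹) * ∫ ω, (a i ω - est N i ω) ^ 2 ∂P := by
    intro s hs N i
    nth_rewrite 1 [← hR i]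
    rw [← integral_sub (hM N i) (hA i), ← hR i, ← integral_const_mul, ← integral_const_mul,
      ← integral_add ((hA i).const_mul _) ((hD N i).const_mul _)]
    refine (abs_integral_le_integral_abs).trans (integral_mono ((hM N i).sub (hA i)).abs
      (((hA i).const_mul _).add ((hD N i).const_mul _)) fun ω => ?_)
    have hs1 : s⁻¹ * s = 1 := inv_mul_cancel₀ hs.ne'
    have key : ∀ x y : ℝ, 2 * (x * y) ≤ s * x ^ 2 + s⁻¹ * y ^ 2 := by
      intro x y
      have h0 : 0 ≤ s⁻¹ * (s * x - y) ^ 2 := by positivity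
      have h1 : s⁻¹ * (s * x - y) ^ 2
          = s⁻¹ * s * (s * x ^ 2) - 2 * (s⁻¹ * s) * (x * y) + s⁻¹ * y ^ 2 := by ring
      rw [h1, hs1] at h0
      linarith
    have k1 := key (μ i ω - a i ω) (a i ω - est N i ω)
    have k2 := key (μ i ω - a i ω) (-(a i ω - est N i ω))
    rw [neg_sq] at k2
    simp only [abs_le]
    constructor <;> nlinarith [sq_nonneg (a i ω - est N i ω)]
  rw [Metric.tendsto_atTop]
  intro e he
  set s : ℝ := e / (2 * (R + 1)) with hs
  have hs0 : 0 < s := by positivity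
  have hsR : s * R < e / 2 := by
    rw [hs, div_mul_eq_mul_div, div_lt_iff₀ (by positivity)]
    nlinarith
  have hlim := (hd.const_mul (1 + s⁻¹)).eventually_lt_const
    (show (1 + s⁻¹) * 0 < e / 2 by rw [mul_zero]; positivity)
  obtain ⟨N₀, hN₀⟩ := eventually_atTop.1 (hlim.and (eventually_gt_atTop 0))
  refine ⟨N₀, fun N hN => ?_⟩
  obtain ⟨h1, h2⟩ := hN₀ N hN
  have hN' : (0 : ℝ) < N := by exact_mod_cast h2
  have hsum : avgMSE P μ N (est N) - R
      = (1 / (N : ℝ)) * ∑ i : Fin N, (∫ ω, (μ i ω - est N i ω) ^ 2 ∂P - R) := by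
    rw [avgMSE, Finset.sum_sub_distrib, Finset.sum_const, Finset.card_univ, Fintype.card_fin,
      nsmul_eq_mul]
    field_simp
  rw [Real.dist_eq, hsum, abs_mul, abs_of_pos (by positivity)]
  calc (1 / (N : ℝ)) * |∑ i : Fin N, (∫ ω, (μ i ω - est N i ω) ^ 2 ∂P - R)|
      ≤ (1 / (N : ℝ)) * ∑ i : Fin N, (s * R + (1 + s⁻¹) *
          ∫ ω, (a i ω - est N i ω) ^ 2 ∂P) := by
        gcongr
        exact (Finset.abs_sum_le_sum_abs _ _).trans (Finset.sum_le_sum fun i _ => hone s hs0 N i)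
    _ = s * R + (1 + s⁻¹) * ((1 / (N : ℝ)) * ∑ i : Fin N,
          ∫ ω, (a i ω - est N i ω) ^ 2 ∂P) := by
        rw [Finset.sum_add_distrib, Finset.sum_const, Finset.card_univ, Fintype.card_fin,
          nsmul_eq_mul, ← Finset.mul_sum]
        field_simp
    _ < e := by linarith

/-- Aurora with nearest neighbours, for features without ties on which every held-out replicate
has the same regression function `f`. -/
theorem mseConverges_aurora_kNN [IsProbabilityMeasure P] {E : Type*} [NormedAddCommGroup E]
    [InnerProductSpace ℝ E] [FiniteDimensional ℝ E] [MeasurableSpace E] [BorelSpace E] {m : ℕ}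
    {μ : ℕ → Ω → ℝ} {Z : ℕ → Fin (m + 1) → Ω → ℝ} {W : ℕ → Fin (m + 1) → Ω → E}
    {ν : Fin (m + 1) → Measure E}
    (hμ : ∀ i, MemLp (μ i) 2 P) (hZm : ∀ i j, Measurable (Z i j)) (hZ : ∀ i j, MemLp (Z i j) 2 P)
    (hW : ∀ i j, Measurable (W i j)) (hind : ∀ j, iIndepFun (fun i ω => (W i j ω, Z i j ω)) P)
    (hν : ∀ i j, P.map (W i j) = ν j) {f : E → ℝ} (hfm : Measurable f)
    (hf : ∀ j, MemLp f 2 (ν j)) {V : Fin (m + 1) → ℝ}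
    (hV : ∀ i j, ∫ ω, (Z i j ω - f (W i j ω)) ^ 2 ∂P ≤ V j)
    (horth : ∀ i j S, MeasurableSet S → ∫ ω in W i j ⁻¹' S, (Z i j ω - f (W i j ω)) ∂P = 0)
    (hties : ∀ j i i₁ i₂, i₁ ≠ i₂ → ∀ᵐ ω ∂P, ‖W i₁ j ω - W i j ω‖ ≠ ‖W i₂ j ω - W i j ω‖)
    {k : ℕ → ℕ} (hk : Tendsto k atTop atTop)
    (hkN : Tendsto (fun N : ℕ => (k N : ℝ) / (N : ℝ)) atTop (𝓝 0)) {R : ℝ}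
    (hR : ∀ i, ∫ ω, (μ i ω - (1 / ((m + 1 : ℕ) : ℝ)) * ∑ j, f (W i j ω)) ^ 2 ∂P = R) :
    MSEConverges P μ (fun N i ω => aurora (kNN (k N)) (fun (i' : Fin N) j => W i' j ω)
      (fun (i' : Fin N) j => Z i' j ω) i) R := by
  have hfW : ∀ i j, MemLp (fun ω => f (W i j ω)) 2 P := fun i j =>
    MemLp.comp_of_map (by rw [hν i j]; exact hf j) (hW i j).aemeasurable
  have hkNN : ∀ N (i : Fin N) j, MemLp (fun ω => kNN (k N) (fun i' : Fin N => W i' j ω)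
      (fun i' : Fin N => Z i' j ω) (W i j ω)) 2 P := fun N i j =>
    memLp_kNN (k N) (W := fun ω (i' : Fin N) => W i' j ω) (Y := fun i' : Fin N => Z i' j)
      (fun i' => hW i' j) (fun i' => hZ i' j) (hW i j)
  have hest : ∀ N (i : Fin N), MemLp (fun ω => aurora (kNN (k N))
      (fun (i' : Fin N) j => W i' j ω) (fun (i' : Fin N) j => Z i' j ω) i) 2 P := fun N i =>
    (memLp_finsetSum _ fun j _ => hkNN N i j).const_mul _
  have hlim : Tendsto (fun N => avgMSE P μ N fun i ω => aurora (kNN (k N))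
      (fun (i' : Fin N) j => W i' j ω) (fun (i' : Fin N) j => Z i' j ω) i) atTop (𝓝 R) := by
    refine tendsto_avgMSE_of_tendsto_avg_sq
      (a := fun i ω => (1 / ((m + 1 : ℕ) : ℝ)) * ∑ j, f (W i j ω)) hμ
      (fun i => (memLp_finsetSum _ fun j _ => hfW i j).const_mul _) hest hR ?_
    have hstone : ∀ j, Tendsto (fun N : ℕ => (1 / (N : ℝ)) * ∑ i : Fin N, ∫ ω, (f (W i j ω) -
        kNN (k N) (fun l : Fin N => W l j ω) (fun l : Fin N => Z l j ω) (W i j ω)) ^ 2 ∂P)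
        atTop (𝓝 0) := fun j =>
      tendsto_avg_integral_sq_kNN_sub (W := fun i => W i j) (Y := fun i => Z i j)
        (fun i => hW i j) (fun i => hZm i j) (hind j) (fun i => hν i j) hfm (hf j)
        (fun i => (hZ i j).sub (hfW i j)) (fun i => hV i j) (fun i => horth i j) (hties j) hk hkN
    have hsum : Tendsto (fun N : ℕ => (1 / ((m + 1 : ℕ) : ℝ)) * ∑ j, ((1 / (N : ℝ)) *
        ∑ i : Fin N, ∫ ω, (f (W i j ω) - kNN (k N) (fun l : Fin N => W l j ω)
          (fun l : Fin N => Z l j ω) (W i j ω)) ^ 2 ∂P)) atTop (𝓝 0) := by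
      simpa using (tendsto_finsetSum Finset.univ fun j _ => hstone j).const_mul
        (1 / ((m + 1 : ℕ) : ℝ))
    refine squeeze_zero (fun N => mul_nonneg (by positivity) (Finset.sum_nonneg fun i _ =>
      integral_nonneg fun ω => sq_nonneg _)) (fun N => ?_) hsum
    calc (1 / (N : ℝ)) * ∑ i : Fin N, _
        ≤ (1 / (N : ℝ)) * ∑ i : Fin N, (1 / ((m + 1 : ℕ) : ℝ)) * ∑ j, ∫ ω, (f (W i j ω) -
          kNN (k N) (fun l : Fin N => W l j ω) (fun l : Fin N => Z l j ω) (W i j ω)) ^ 2 ∂P := by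
          refine mul_le_mul_of_nonneg_left (Finset.sum_le_sum fun i _ => ?_) (by positivity)
          refine le_trans (le_of_eq ?_)
            (integral_sq_avg_le fun j => (hfW i j).sub (hkNN N i j))
          simp only [aurora, Finset.sum_sub_distrib, mul_sub]
      _ = _ := by
          rw [← Finset.mul_sum, ← Finset.mul_sum, mul_left_comm, Finset.sum_comm]
  exact ⟨fun N i => ((hμ i).sub (hest N i)).integrable_sq, hlim, hlim.limsup_eq⟩

end AveragedRegression

/-! ### The oracle as a regression function -/

section Model

variable {A Ω : Type*} [MeasurableSpace A] [MeasurableSpace Ω] {m : ℕ}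
  {G : Measure (ℝ × A)} {F : Kernel (ℝ × A) ℝ} {P : Measure Ω}
  {μ : ℕ → Ω → ℝ} {α : ℕ → Ω → A} {Z : ℕ → Fin (m + 1) → Ω → ℝ}

theorem ReplicateModel.measurable_features (h : ReplicateModel G F P μ α Z) (i : ℕ)
    (j : Fin (m + 1)) : Measurable fun ω => orderStats (fun l => Z i l ω) j :=
  (measurable_orderStats j).comp (measurable_snd.comp (h.measurable_unit i))

variable [IsMarkovKernel F] [IsProbabilityMeasure P]

/-- The latent mean and the features have the same joint law for all units and all replicates
held out. -/
theorem ReplicateModel.identDistrib_features (h : ReplicateModel G F P μ α Z) (i i' : ℕ)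
    (j j' : Fin (m + 1)) :
    IdentDistrib (fun ω => (μ i ω, orderStats (fun l => Z i l ω) j))
      (fun ω => (μ i' ω, orderStats (fun l => Z i' l ω) j')) P P :=
  (h.identDistrib_removeNth i i' j j').comp
    (u := fun p : (ℝ × A) × (Fin m → ℝ) => (p.1.1, sortedVector p.2))
    ((measurable_fst.comp measurable_fst).prodMk (measurable_sortedVector.comp measurable_snd))

/-- One function of the features is the oracle for all units and all replicates held out. -/
theorem ReplicateModel.exists_oracle_eq_comp (h : ReplicateModel G F P μ α Z)
    (hμ : ∀ i, MemLp (μ i) 2 P) :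
    ∃ f : EuclideanSpace ℝ (Fin m) → ℝ, Measurable f ∧
      ∀ i j, oracle P (μ i) (Z i) j =ᵐ[P] fun ω => f (orderStats (fun l => Z i l ω) j) := by
  have hsm : StronglyMeasurable[MeasurableSpace.comap
      (fun ω => orderStats (fun l => Z 0 l ω) 0) inferInstance] (oracle P (μ 0) (Z 0) 0) :=
    stronglyMeasurable_condExp
  obtain ⟨f, hf, hfe⟩ := hsm.exists_eq_measurable_comp
  exact ⟨f, hf.measurable, fun i j => condExp_comap_eq_comp_of_identDistrib
    (h.measurable_features 0 0) (h.measurable_features i j) ((hμ 0).integrable (by norm_num))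
    (h.identDistrib_features 0 i 0 j) hf.measurable (EventuallyEq.of_eq hfe)⟩

/-- The held-out replicate and the latent mean have the same regression function on the
features. -/
theorem ReplicateModel.setIntegral_heldOut_sub_oracle [IsProbabilityMeasure G]
    (h : ReplicateModel G F P μ α Z)
    (hμ : ∀ i, MemLp (μ i) 2 P) (hZ : ∀ i j, MemLp (Z i j) 2 P)
    {f : EuclideanSpace ℝ (Fin m) → ℝ} {i : ℕ} {j : Fin (m + 1)}
    (hf : oracle P (μ i) (Z i) j =ᵐ[P] fun ω => f (orderStats (fun l => Z i l ω) j))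
    {S : Set (EuclideanSpace ℝ (Fin m))} (hS : MeasurableSet S) :
    ∫ ω in (fun ω => orderStats (fun l => Z i l ω) j) ⁻¹' S,
      (Z i j ω - f (orderStats (fun l => Z i l ω) j)) ∂P = 0 := by
  have hX := h.measurable_features i j
  have hμi : Integrable (μ i) P := (hμ i).integrable (by norm_num)
  have hZi : Integrable (Z i j) P := (hZ i j).integrable (by norm_num)
  have hfI : Integrable (fun ω => f (orderStats (fun l => Z i l ω) j)) P :=
    integrable_condExp.congr hf
  have h1 := h.setIntegral_heldOut_sub_mean hμ hZ i j (measurable_sortedVector hS)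
  have h2 := setIntegral_condExp hX.comap_le hμi (s := (fun ω =>
    orderStats (fun l => Z i l ω) j) ⁻¹' S) ⟨S, hS, rfl⟩
  have h3 : ∫ ω in (fun ω => orderStats (fun l => Z i l ω) j) ⁻¹' S,
      oracle P (μ i) (Z i) j ω ∂P = ∫ ω in (fun ω => orderStats (fun l => Z i l ω) j) ⁻¹' S,
      f (orderStats (fun l => Z i l ω) j) ∂P :=
    setIntegral_congr_ae (hX hS) (hf.mono fun ω hω _ => hω)
  rw [integral_sub hZi.integrableOn hμi.integrableOn] at h1
  rw [integral_sub hZi.integrableOn hfI.integrableOn, ← h3]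
  exact (congrArg _ h2).trans h1

end Model

end Aurora

/-! ### The risk of Aurora with nearest neighbours -/

theorem theorem2 {A Ω : Type*} [MeasurableSpace A] [MeasurableSpace Ω] {m : ℕ}
    (G : Measure (ℝ × A)) [IsProbabilityMeasure G]
    (F : Kernel (ℝ × A) ℝ) [IsMarkovKernel F]
    (P : Measure Ω) [IsProbabilityMeasure P]
    (μ : ℕ → Ω → ℝ) (α : ℕ → Ω → A) (Z : ℕ → Fin (m + 1) → Ω → ℝ)
    (hmodel : Aurora.ReplicateModel G F P μ α Z)
    (hμ : ∀ i, MemLp (μ i) 2 P) (hZ : ∀ i j, MemLp (Z i j) 2 P)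
    (k : ℕ → ℕ) (hk : Tendsto k atTop atTop)
    (hkN : Tendsto (fun N : ℕ => (k N : ℝ) / (N : ℝ)) atTop (𝓝 0)) (i₀ : ℕ) :
    -- randomized tie-breaking, no further assumption
    (∀ (ε : ℝ) (U : ℕ → Fin (m + 1) → Ω → ℝ), 0 < ε → Aurora.TieBreakers ε P μ α Z U →
      Aurora.MSEConverges P μ
        (fun N i ω => Aurora.auroraKNNTie (k N) (fun (i' : Fin N) j => Z i' j ω)
          (fun (i' : Fin N) j => U i' j ω) i)
        (Aurora.avgOracleRisk P (μ i₀) (Z i₀))) ∧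
    -- without tie-breaking, when ties have probability zero
    (Aurora.NoTies P Z →
      Aurora.MSEConverges P μ
        (fun N i ω => Aurora.auroraKNN (k N) (fun (i' : Fin N) j => Z i' j ω) i)
        (Aurora.avgOracleRisk P (μ i₀) (Z i₀))) ∧
    (∀ j, Aurora.avgOracleRisk P (μ i₀) (Z i₀) ≤ Aurora.bayesRisk P (μ i₀) (Z i₀) j) := by
  obtain ⟨f, hfm, hf⟩ := hmodel.exists_oracle_eq_comp hμ
  have hX := hmodel.measurable_features
  have hfX : ∀ i j, MemLp (fun ω => f (Aurora.orderStats (fun l => Z i l ω) j)) 2 P :=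
    fun i j => ((hμ i).condExp one_le_two).ae_eq (hf i j)
  have hV : ∀ i j, ∫ ω, (Z i j ω - f (Aurora.orderStats (fun l => Z i l ω) j)) ^ 2 ∂P
      = ∫ ω, (Z 0 j ω - f (Aurora.orderStats (fun l => Z 0 l ω) j)) ^ 2 ∂P := fun i j =>
    ((hmodel.identDistrib_unit i 0).comp
      (u := fun p : (ℝ × A) × (Fin (m + 1) → ℝ) => (p.2 j - f (Aurora.orderStats p.2 j)) ^ 2)
      (((measurable_pi_apply j).comp measurable_snd |>.sub (hfm.comp
        ((Aurora.measurable_orderStats j).comp measurable_snd))).pow_const 2)).integral_eq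
  have hR : ∀ i, ∫ ω, (μ i ω - (1 / ((m + 1 : ℕ) : ℝ)) *
      ∑ j, f (Aurora.orderStats (fun l => Z i l ω) j)) ^ 2 ∂P
      = Aurora.avgOracleRisk P (μ i₀) (Z i₀) := by
    intro i
    refine Eq.trans (((hmodel.identDistrib_unit i i₀).comp
      (u := fun p : (ℝ × A) × (Fin (m + 1) → ℝ) => (p.1.1 - (1 / ((m + 1 : ℕ) : ℝ)) *
        ∑ j, f (Aurora.orderStats p.2 j)) ^ 2) ?_).integral_eq) (integral_congr_ae ?_)
    · refine ((measurable_fst.comp measurable_fst).sub (Measurable.const_mul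
        (Finset.measurable_sum _ fun j _ => ?_) _)).pow_const 2
      exact hfm.comp ((Aurora.measurable_orderStats j).comp measurable_snd)
    · filter_upwards [ae_all_iff.2 (hf i₀)] with ω hω
      simp [hω]
  refine ⟨fun ε U hε hU => ?_, fun hties => ?_, fun j => ?_⟩
  · have hunits := hmodel.measurable_unit
    -- units with their tie-breakers: independent, and each unit independent of its tie-breaker
    have hpairs : ∀ j, iIndepFun
        (fun i ω => (((μ i ω, α i ω), fun j => Z i j ω), U i j ω)) P := fun j =>
      Aurora.iIndepFun_prodMk_of_indepFun hunits (fun i => hU.measurable i j) hmodel.units_indep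
        (hU.indep.precomp (g := fun i => (i, j)) fun a b hab => (Prod.ext_iff.1 hab).1)
        (hU.indep_model.comp (φ := fun u : ℕ → Fin (m + 1) → ℝ => fun i => u i j)
          (by fun_prop) measurable_id)
    have hZU : ∀ i j, IndepFun (fun ω l => Z i l ω) (U i j) P := fun i j =>
      (hU.indep_model.comp (φ := fun u : ℕ → Fin (m + 1) → ℝ => u i j)
        (ψ := fun x : ℕ → (ℝ × A) × (Fin (m + 1) → ℝ) => (x i).2)
        (by fun_prop) (by fun_prop)).symm
    have hZall : ∀ i, Measurable fun ω l => Z i l ω := fun i =>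
      measurable_snd.comp (hunits i)
    have hW : ∀ i j, Measurable fun ω =>
        Aurora.orderStatsTie (fun l => Z i l ω) j (U i j ω) := fun i j =>
      (Aurora.measurable_orderStatsTie j).comp ((hZall i).prodMk (hU.measurable i j))
    -- the regression function ignores the tie-breaking coordinate
    have hdrop : ∀ i j ω, (f ∘ Aurora.dropTie) (Aurora.orderStatsTie (fun l => Z i l ω) j
        (U i j ω)) = f (Aurora.orderStats (fun l => Z i l ω) j) := fun i j ω => by
      rw [Function.comp_apply, Aurora.dropTie_orderStatsTie]
    have hν : ∀ i j, P.map (fun ω => Aurora.orderStatsTie (fun l => Z i l ω) j (U i j ω))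
        = P.map (fun ω => Aurora.orderStatsTie (fun l => Z 0 l ω) j (U 0 j ω)) := by
      intro i j
      have hmap : ∀ i, P.map (fun ω => Aurora.orderStatsTie (fun l => Z i l ω) j (U i j ω))
          = ((P.map fun ω l => Z i l ω).prod (cond volume (Set.Icc 0 ε))).map
            fun p => Aurora.orderStatsTie p.1 j p.2 := by
        intro i
        have huni : P.map (U i j) = cond volume (Set.Icc 0 ε) := hU.uniform i j
        rw [← huni, ← (indepFun_iff_map_prod_eq_prod_map_map (hZall i).aemeasurable
          (hU.measurable i j).aemeasurable).1 (hZU i j), Measure.map_map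
          (Aurora.measurable_orderStatsTie j) ((hZall i).prodMk (hU.measurable i j))]
        rfl
      have hlaw : P.map (fun ω l => Z i l ω) = P.map fun ω l => Z 0 l ω :=
        ((hmodel.identDistrib_unit i 0).comp measurable_snd).map_eq
      rw [hmap, hmap, hlaw]
    refine Aurora.mseConverges_aurora_kNN hμ hmodel.measurable_replicate hZ hW (fun j => ?_) hν
      (hfm.comp Aurora.measurable_dropTie) (fun j => ?_)
      (V := fun j => ∫ ω, (Z 0 j ω - f (Aurora.orderStats (fun l => Z 0 l ω) j)) ^ 2 ∂P)
      (fun i j => ?_) (fun i j S hS => ?_)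
      (fun j => ?_) hk hkN (fun i => ?_)
    · exact (hpairs j).comp (fun _ p => (Aurora.orderStatsTie p.1.2 j p.2, p.1.2 j)) fun _ =>
        ((Aurora.measurable_orderStatsTie j).comp
          ((measurable_snd.comp measurable_fst).prodMk measurable_snd)).prodMk (by fun_prop)
    · rw [memLp_map_measure_iff (hfm.comp Aurora.measurable_dropTie).aestronglyMeasurable
        (hW 0 j).aemeasurable]
      exact (hfX 0 j).ae_eq (Eventually.of_forall fun ω => (hdrop 0 j ω).symm)
    · simp_rw [hdrop]
      exact (hV i j).le
    · simp_rw [hdrop]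
      refine Aurora.setIntegral_appendTie_eq_zero (hX i j)
        ((hmodel.measurable_replicate i j).sub (hfm.comp (hX i j))) (hU.measurable i j) ?_
        (fun S hS => hmodel.setIntegral_heldOut_sub_oracle hμ hZ (hf i j) hS) hS
      exact (hZU i j).comp (φ := fun z : Fin (m + 1) → ℝ =>
        (Aurora.orderStats z j, z j - f (Aurora.orderStats z j)))
        ((Aurora.measurable_orderStats j).prodMk ((measurable_pi_apply j).sub
          (hfm.comp (Aurora.measurable_orderStats j)))) measurable_id
    · exact Aurora.ae_norm_sub_ne_of_sphere_null (fun i => hW i j)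
        ((hpairs j).comp (fun _ p => Aurora.orderStatsTie p.1.2 j p.2) fun _ =>
          (Aurora.measurable_orderStatsTie j).comp
            ((measurable_snd.comp measurable_fst).prodMk measurable_snd)) fun i a r => by
        have : NullSingletonClass (P.map (U i j)) := ⟨fun u =>
          (hU.uniform i j).absolutelyContinuous (measure_singleton u)⟩
        exact Aurora.map_orderStatsTie_sphere_eq_zero (hZall i) (hU.measurable i j) (hZU i j) j a r
    · simp_rw [hdrop]
      exact hR i
  · refine Aurora.mseConverges_aurora_kNN hμ hmodel.measurable_replicate hZ hX (fun j => ?_)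
      (fun i j => ((hmodel.identDistrib_features i 0 j j).comp measurable_snd).map_eq) hfm
      (fun j => ?_) (fun i j => (hV i j).le)
      (fun i j S hS => hmodel.setIntegral_heldOut_sub_oracle hμ hZ (hf i j) hS) hties hk hkN hR
    · exact hmodel.units_indep.comp (fun _ p => (Aurora.orderStats p.2 j, p.2 j)) fun _ =>
        ((Aurora.measurable_orderStats j).comp measurable_snd).prodMk (by fun_prop)
    · exact (memLp_map_measure_iff hfm.aestronglyMeasurable (hX 0 j).aemeasurable).2 (hfX 0 j)
  · have hbayes : ∀ j, Aurora.bayesRisk P (μ i₀) (Z i₀) j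
        = ∫ ω, (μ i₀ ω - f (Aurora.orderStats (fun l => Z i₀ l ω) j)) ^ 2 ∂P := fun j =>
      integral_congr_ae ((hf i₀ j).mono fun ω hω => by simp [hω])
    -- the Bayes risks for the different held-out indices coincide, as the joint laws do
    have hsame : ∀ j', Aurora.bayesRisk P (μ i₀) (Z i₀) j'
        = Aurora.bayesRisk P (μ i₀) (Z i₀) j := fun j' => by
      rw [hbayes, hbayes]
      exact ((hmodel.identDistrib_features i₀ i₀ j' j).comp
        (u := fun p : ℝ × EuclideanSpace ℝ (Fin m) => (p.1 - f p.2) ^ 2)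
        ((measurable_fst.sub (hfm.comp measurable_snd)).pow_const 2)).integral_eq
    rw [← hR i₀]
    have hle := Aurora.integral_sq_avg_le (P := P) fun j => (hμ i₀).sub (hfX i₀ j)
    simp only [Pi.sub_apply, ← hbayes, hsame, Finset.sum_const, Finset.card_univ,
      Fintype.card_fin, Finset.sum_sub_distrib, nsmul_eq_mul] at hle
    have hK : (0 : ℝ) < ((m + 1 : ℕ) : ℝ) := by positivity
    refine le_trans (le_of_eq (integral_congr_ae (Eventually.of_forall fun ω => ?_)))
      (hle.trans_eq ?_)
    · simp only
      congr 1
      field_simp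
    · field_simp
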